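/- All manifolds and maps are $C^\infty$; manifolds are Hausdorff and second countable. Let $E$ be a manifold of dimension $n+1$ and $\pi\colon E\to\mathbb R$ a surjective submersion (for instance a smooth fibre bundle), let $k\ge 1$, and let $t$ be the coordinate of $\mathbb R$. For $r\ge 0$ let $J^r\pi$ be the manifold of $r$-jets $j^r_t\phi$ of local sections $\phi$ of $\pi$. A chart $(t,q^A)$ of $E$ adapted to $\pi$ induces on $J^r\pi$ the coordinates $(t,q_0^A,\dots,q_r^A)$, $q_i^A=d^i\phi^A/dt^i$. Let $\pi^r_s\colon J^r\pi\to J^s\pi$ ($s\le r$) and $\bar\pi^r\colon J^r\pi\to\mathbb R$ be the projections, and let $$J^{k-1}\pi^*=T^*(J^{k-1}\pi)/(\bar\pi^{k-1})^*T^*\mathbb R,$$ with quotient map $\mu\colon T^*(J^{k-1}\pi)\to J^{k-1}\pi^*$. It has induced coordinates $(t,q_i^A,p^i_A)$, $0\le i\le k-1$, where $p^i_A$ is the coefficient of $dq_i^A$. Let $\mathcal L=L\,dt$ be a Lagrangian density of order $k$, where $L\in C^\infty(J^k\pi)$. For a function $f$ on (an open subset of) $J^r\pi$, let $d_Tf$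 be its total time derivative, $(d_Tf)(j^{r+1}_t\phi)=\frac{d}{ds}\big|_{s=t}f(j^r_s\phi)$. The restricted Legendre–Ostrogradsky map $\mathcal{FL}\colon J^{2k-1}\pi\to J^{k-1}\pi^*$ is the map over $J^{k-1}\pi$ given in induced coordinates by $$\mathcal{FL}^*p^{r-1}_A=\sum_{i=0}^{k-r}(-1)^i d_T^i\Big(\frac{\partial L}{\partial q^A_{r+i}}\Big),\qquad 1\le r\le k.$$ $\mathcal L$ is called hyperregular if $\mathcal{FL}$ is a (global) diffeomorphism. Let $\mathcal W=J^{2k-1}\pi\times_{J^{k-1}\pi}T^*(J^{k-1}\pi)$. For $w=(\bar y,\alpha)\in\mathcal W$ with $\bar y=j^{2k-1}_t\phi$, put $\hat C(w)=\langle\alpha,\tfrac{d}{ds}\big|_{s=t}j^{k-1}_s\phi\rangle$. In coordinates, with $p$ the coefficient of $dt$ in $\alpha$, this is $\hat C=p+p^i_Aq^A_{i+1}$. Let $$\mathcal W_o=\{(\bar y,\alpha)\in\mathcal W:\hat C(\bar y,\alpha)=L(\pi^{2k-1}_k(\bar y))\},\qquad \mathcal W_1=\{(\bar y,\alpha)\in\mathcal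 W_o:\mu(\alpha)=\mathcal{FL}(\bar y)\},$$ and let $\rho_1^1\colon\mathcal W_1\to J^{2k-1}\pi$, $(\bar y,\alpha)\mapsto\bar y$, and $\hat\rho_2^1\colon\mathcal W_1\to J^{k-1}\pi^*$, $(\bar y,\alpha)\mapsto\mu(\alpha)$, be the projections. If $\mathcal L$ is hyperregular, then $\mathcal W_1$ is an embedded submanifold of $J^{2k-1}\pi\times T^*(J^{k-1}\pi)$, and for its structure of embedded submanifold $\hat\rho_2^1\colon\mathcal W_1\to J^{k-1}\pi^*$ is a diffeomorphism. Moreover $\hat\rho_2^1=\mathcal{FL}\circ\rho_1^1$. -/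

import Mathlib

open Set Filter Topology
open scoped Manifold ContDiff

noncomputable section

namespace HigherOrderMechanics

/-- The model space of the `k`-jets, with coordinates `(t, q_0, …, q_k)`, `q_i ∈ ℝⁿ`. -/
abbrev JetModel (n k : ℕ) : Type := ℝ × (Fin (k + 1) → Fin n → ℝ)

/-- A configuration bundle: a smooth surjective submersion `π : E → ℝ`, `dim E = n + 1`. -/
structure ConfigBundle (n : ℕ) (E : Type*) [TopologicalSpace E]
    [ChartedSpace (EuclideanSpace ℝ (Fin (n + 1))) E] where
  proj : E → ℝ
  isSubmersion : Manifold.IsSubmersion (𝓡 (n + 1)) 𝓘(ℝ, ℝ) ∞ proj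
  surjective : Function.Surjective proj

variable {n : ℕ} {E : Type*} [TopologicalSpace E]
  [ChartedSpace (EuclideanSpace ℝ (Fin (n + 1))) E]

/-- A nonempty chart `(t, q^A)` of `E` adapted to the bundle structure. -/
structure AdaptedChart (π : ConfigBundle n E) where
  chart : OpenPartialHomeomorph E (ℝ × (Fin n → ℝ))
  nonempty : chart.source.Nonempty
  contMDiffOn : ContMDiffOn (𝓡 (n + 1)) 𝓘(ℝ, ℝ × (Fin n → ℝ)) ∞ chart chart.source
  contMDiffOn_symm :
    ContMDiffOn 𝓘(ℝ, ℝ × (Fin n → ℝ)) (𝓡 (n + 1)) ∞ chart.symm chart.target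
  fst_eq : ∀ x ∈ chart.source, (chart x).1 = π.proj x

/-- Every point lies in the domain of an adapted chart. -/
theorem AdaptedChart.exists_mem [IsManifold (𝓡 (n + 1)) ∞ E] (π : ConfigBundle n E) (x : E) :
    ∃ e : AdaptedChart π, x ∈ e.chart.source := by
  have hx := π.isSubmersion.isSubmersionAt x
  let φ := hx.domChart
  let ψ := hx.codChart
  have hφ : φ ∈ IsManifold.maximalAtlas (𝓡 (n + 1)) ∞ E := hx.domChart_mem_maximalAtlas
  have hψ : ψ ∈ IsManifold.maximalAtlas 𝓘(ℝ, ℝ) ∞ ℝ := hx.codChart_mem_maximalAtlas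
  let eqv := hx.equiv
  have hw := hx.writtenInCharts
  have hsub := hx.source_subset_preimage_source
  have hxφ : x ∈ φ.source := hx.mem_domChart_source
  have hfd : FiniteDimensional ℝ hx.complement :=
    Module.Finite.of_surjective
      ((LinearMap.snd ℝ ℝ hx.complement).comp eqv.toLinearEquiv.toLinearMap)
      (fun v => ⟨eqv.symm (0, v), by simp⟩)
  have hrank : Module.finrank ℝ hx.complement = n := by
    have h1 := eqv.toLinearEquiv.finrank_eq
    rw [Module.finrank_prod, finrank_euclideanSpace_fin, Module.finrank_self] at h1
    omega
  let lin : hx.complement ≃L[ℝ] (Fin n → ℝ) :=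
    ContinuousLinearEquiv.ofFinrankEq (by rw [hrank]; simp)
  let c : OpenPartialHomeomorph E (ℝ × (Fin n → ℝ)) :=
    (φ.trans eqv.toHomeomorph.toOpenPartialHomeomorph).trans
      (ψ.symm.prod lin.toHomeomorph.toOpenPartialHomeomorph)
  have key : ∀ z ∈ φ.source, (eqv (φ z)).1 = ψ (π.proj z) := by
    intro z hz
    have := hw (x := φ z) (by simpa using φ.map_source hz)
    simp only [Function.comp_apply] at this
    rw [← this]
    simp only [OpenPartialHomeomorph.extend_coe, modelWithCornersSelf_coe, Function.comp_apply,
      id, OpenPartialHomeomorph.extend_coe_symm, modelWithCornersSelf_coe_symm]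
    exact congrArg (fun y => ψ (π.proj y)) (φ.left_inv hz).symm |>.symm
  have hmem : ∀ z ∈ φ.source, z ∈ c.source := by
    intro z hz
    have h2 : (eqv (φ z)).1 ∈ ψ.target := by
      rw [key z hz]; exact ψ.map_source (hsub hz)
    simp [c, hz, h2]
  have hsrc : c.source ⊆ φ.source := by
    intro z hz
    simp only [c, mfld_simps] at hz
    exact hz.1
  refine ⟨⟨c, ⟨x, hmem x hxφ⟩, ?_, ?_, ?_⟩, hmem x hxφ⟩
  · have h1 : ContMDiffOn (𝓡 (n + 1)) 𝓘(ℝ, EuclideanSpace ℝ (Fin (n + 1))) ∞ φ φ.source :=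
      contMDiffOn_of_mem_maximalAtlas hφ
    have h2 : ContMDiffOn 𝓘(ℝ, ℝ) 𝓘(ℝ, ℝ) ∞ ψ.symm ψ.target :=
      contMDiffOn_symm_of_mem_maximalAtlas hψ
    have h3 : ContMDiffOn (𝓡 (n + 1)) 𝓘(ℝ, ℝ × hx.complement) ∞ (fun z => eqv (φ z)) c.source :=
      eqv.contDiff.contMDiff.comp_contMDiffOn (h1.mono hsrc)
    have h4 : ContMDiffOn (𝓡 (n + 1)) 𝓘(ℝ, ℝ) ∞ (fun z => ψ.symm (eqv (φ z)).1) c.source := by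
      refine h2.comp (contDiff_fst.contMDiff.comp_contMDiffOn h3) ?_
      intro z hz
      change (eqv (φ z)).1 ∈ ψ.target
      rw [key z (hsrc hz)]; exact ψ.map_source (hsub (hsrc hz))
    have h5 : ContMDiffOn (𝓡 (n + 1)) 𝓘(ℝ, Fin n → ℝ) ∞ (fun z => lin (eqv (φ z)).2) c.source :=
      (lin.contDiff.comp contDiff_snd).contMDiff.comp_contMDiffOn h3
    exact h4.prodMk_space h5
  · have h1 : ContMDiffOn 𝓘(ℝ, EuclideanSpace ℝ (Fin (n + 1))) (𝓡 (n + 1)) ∞ φ.symm φ.target :=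
      contMDiffOn_symm_of_mem_maximalAtlas hφ
    have h2 : ContMDiffOn 𝓘(ℝ, ℝ) 𝓘(ℝ, ℝ) ∞ ψ ψ.source :=
      contMDiffOn_of_mem_maximalAtlas hψ
    have ht : ∀ p ∈ c.target, p.1 ∈ ψ.source ∧ eqv.symm (ψ p.1, lin.symm p.2) ∈ φ.target := by
      intro p hp
      simp only [c, mfld_simps] at hp
      exact ⟨hp.1, hp.2⟩
    have h3 : ContMDiffOn 𝓘(ℝ, ℝ × (Fin n → ℝ)) 𝓘(ℝ, ℝ) ∞
        (fun p : ℝ × (Fin n → ℝ) => ψ p.1) c.target :=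
      h2.comp contDiff_fst.contMDiff.contMDiffOn (fun p hp => (ht p hp).1)
    have h4 : ContMDiffOn 𝓘(ℝ, ℝ × (Fin n → ℝ)) 𝓘(ℝ, hx.complement) ∞
        (fun p : ℝ × (Fin n → ℝ) => lin.symm p.2) c.target :=
      (lin.symm.contDiff.comp contDiff_snd).contMDiff.contMDiffOn
    exact h1.comp (eqv.symm.contDiff.contMDiff.comp_contMDiffOn (h3.prodMk_space h4))
      (fun p hp => (ht p hp).2)
  · intro z hz
    change ψ.symm (eqv (φ z)).1 = π.proj z
    rw [key z (hsrc hz)]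
    exact ψ.left_inv (hsub (hsrc hz))

/-- `φ` is a smooth section of `π` on a neighbourhood of `t`. -/
structure IsLocalSectionAt (π : ConfigBundle n E) (φ : ℝ → E) (t : ℝ) : Prop where
  section_eq : ∀ᶠ s in 𝓝 t, π.proj (φ s) = s
  smooth : ∀ᶠ s in 𝓝 t, ContMDiffAt 𝓘(ℝ, ℝ) (𝓡 (n + 1)) ∞ φ s

/-- A smooth local section of `π` together with a point of its domain. -/
structure LocalSection (π : ConfigBundle n E) where
  time : ℝ
  toFun : ℝ → E
  isLocalSectionAt : IsLocalSectionAt π toFun time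

/-- The components `φ^A` of a section in an adapted chart. -/
def AdaptedChart.components {π : ConfigBundle n E} (e : AdaptedChart π) (φ : ℝ → E) :
    ℝ → Fin n → ℝ := fun s => (e.chart (φ s)).2

/-- Two local sections have the same `k`-jet if they are based at the same time, pass through the
same point there, and their components have the same derivatives up to order `k` there. -/
def jetSetoid (π : ConfigBundle n E) (k : ℕ) : Setoid (LocalSection π) where
  r a b := a.time = b.time ∧ a.toFun a.time = b.toFun b.time ∧
    ∀ e : AdaptedChart π, a.toFun a.time ∈ e.chart.source → ∀ i ≤ k,
      iteratedDeriv i (e.components a.toFun) a.time = iteratedDeriv i (e.components b.toFun) b.time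
  iseqv :=
    { refl := fun _ => ⟨rfl, rfl, fun _ _ _ _ => rfl⟩
      symm := fun h => ⟨h.1.symm, h.2.1.symm,
        fun e he i hi => (h.2.2 e (h.2.1 ▸ he) i hi).symm⟩
      trans := fun h h' => ⟨h.1.trans h'.1, h.2.1.trans h'.2.1, fun e he i hi =>
        (h.2.2 e he i hi).trans (h'.2.2 e (h.2.1 ▸ he) i hi)⟩ }

/-- The `k`-th order jet bundle `J^k π`: the set of `k`-jets of local sections of `π`. -/
def Jet (π : ConfigBundle n E) (k : ℕ) : Type _ := Quotient (jetSetoid π k)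

variable {π : ConfigBundle n E} {k : ℕ}

/-- The `k`-jet of a section at its base time. -/
def Jet.mk (k : ℕ) (a : LocalSection π) : Jet π k := Quotient.mk (jetSetoid π k) a

/-- A representative of a `k`-jet. -/
def Jet.rep (y : Jet π k) : LocalSection π := Quotient.out (s := jetSetoid π k) y

theorem Jet.mk_rep (y : Jet π k) : Jet.mk k y.rep = y := Quotient.out_eq (s := jetSetoid π k) y

theorem Jet.mk_eq_iff {a b : LocalSection π} : Jet.mk k a = Jet.mk k b ↔
    a.time = b.time ∧ a.toFun a.time = b.toFun b.time ∧
    ∀ e : AdaptedChart π, a.toFun a.time ∈ e.chart.source → ∀ i ≤ k,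
      iteratedDeriv i (e.components a.toFun) a.time =
        iteratedDeriv i (e.components b.toFun) b.time :=
  Quotient.eq (r := jetSetoid π k)

/-- The projection `J^k π → ℝ`. -/
def Jet.time : Jet π k → ℝ := Quotient.lift (fun a => a.time) fun _ _ h => h.1

/-- The projection `J^k π → E`. -/
def Jet.base : Jet π k → E := Quotient.lift (fun a => a.toFun a.time) fun _ _ h => h.2.1

/-- The projection `J^k π → J^r π` for `r ≤ k`. -/
def Jet.trunc {r : ℕ} (h : r ≤ k) : Jet π k → Jet π r :=
  Quotient.lift (fun a => Jet.mk r a) fun _ _ hab => Jet.mk_eq_iff.2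
    ⟨hab.1, hab.2.1, fun e he i hi => hab.2.2 e he i (hi.trans h)⟩

theorem Jet.time_rep (y : Jet π k) : y.rep.time = y.time := congrArg Jet.time y.mk_rep

theorem Jet.base_rep (y : Jet π k) : y.rep.toFun y.rep.time = y.base := congrArg Jet.base y.mk_rep

theorem LocalSection.proj_eq (a : LocalSection π) : π.proj (a.toFun a.time) = a.time :=
  a.isLocalSectionAt.section_eq.self_of_nhds

theorem IsLocalSectionAt.contMDiffAt {φ : ℝ → E} {t : ℝ} (h : IsLocalSectionAt π φ t) :
    ContMDiffAt 𝓘(ℝ, ℝ) (𝓡 (n + 1)) ∞ φ t := h.smooth.self_of_nhds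

theorem AdaptedChart.contDiffAt_components (e : AdaptedChart π) {φ : ℝ → E} {t : ℝ}
    (h : IsLocalSectionAt π φ t) (ht : φ t ∈ e.chart.source) :
    ContDiffAt ℝ ∞ (e.components φ) t := by
  have h1 : ContMDiffAt (𝓡 (n + 1)) 𝓘(ℝ, ℝ × (Fin n → ℝ)) ∞ e.chart (φ t) :=
    e.contMDiffOn.contMDiffAt (e.chart.open_source.mem_nhds ht)
  exact contDiffAt_snd.comp t (h1.comp t h.contMDiffAt).contDiffAt

/-- Near `t`, the section is `s ↦ e⁻¹ (s, φ^A(s))`. -/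
theorem AdaptedChart.eventually_symm_components (e : AdaptedChart π) {φ : ℝ → E} {t : ℝ}
    (h : IsLocalSectionAt π φ t) (ht : φ t ∈ e.chart.source) :
    ∀ᶠ s in 𝓝 t, (s, e.components φ s) ∈ e.chart.target ∧
      e.chart.symm (s, e.components φ s) = φ s := by
  have hc : ∀ᶠ s in 𝓝 t, φ s ∈ e.chart.source :=
    h.contMDiffAt.continuousAt.preimage_mem_nhds (e.chart.open_source.mem_nhds ht)
  filter_upwards [hc, h.section_eq] with s hs hs2
  have h1 : (s, e.components φ s) = e.chart (φ s) := by
    refine Prod.ext ?_ rfl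
    rw [e.fst_eq _ hs, hs2]
  rw [h1]
  exact ⟨e.chart.map_source hs, e.chart.left_inv hs⟩

/-- The derivatives of a composite up to order `k` only depend on those of the inner map. -/
theorem iteratedDeriv_comp_congr {V W : Type*} [NormedAddCommGroup V] [NormedSpace ℝ V]
    [NormedAddCommGroup W] [NormedSpace ℝ W] {g : V → W} {f₁ f₂ : ℝ → V} {t : ℝ} {k : ℕ}
    (hg : ContDiffAt ℝ ∞ g (f₁ t)) (h₁ : ContDiffAt ℝ ∞ f₁ t) (h₂ : ContDiffAt ℝ ∞ f₂ t)
    (h : ∀ i ≤ k, iteratedDeriv i f₁ t = iteratedDeriv i f₂ t) :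
    ∀ i ≤ k, iteratedDeriv i (g ∘ f₁) t = iteratedDeriv i (g ∘ f₂) t := by
  intro i hi
  have h0 : f₁ t = f₂ t := by simpa using h 0 (Nat.zero_le _)
  have hF : ∀ j ≤ k, iteratedFDeriv ℝ j f₁ t = iteratedFDeriv ℝ j f₂ t := by
    intro j hj
    simp only [iteratedFDeriv_eq_equiv_comp, Function.comp_apply, h j hj]
  have hcomp : iteratedFDeriv ℝ i (g ∘ f₁) t = iteratedFDeriv ℝ i (g ∘ f₂) t := by
    rw [iteratedFDeriv_comp hg h₁ (by exact_mod_cast le_top),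
      iteratedFDeriv_comp (h0 ▸ hg) h₂ (by exact_mod_cast le_top), h0]
    unfold FormalMultilinearSeries.taylorComp
    refine Finset.sum_congr rfl fun c _ => ?_
    unfold FormalMultilinearSeries.compAlongOrderedFinpartition
    congr 1
    funext m
    exact hF _ ((c.partSize_le m).trans hi)
  simp only [iteratedDeriv, hcomp]

theorem iteratedDeriv_prodMk_congr {V : Type*} [NormedAddCommGroup V] [NormedSpace ℝ V]
    {f₁ f₂ : ℝ → V} {t : ℝ} {k : ℕ} (h₁ : ContDiffAt ℝ ∞ f₁ t) (h₂ : ContDiffAt ℝ ∞ f₂ t)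
    (h : ∀ i ≤ k, iteratedDeriv i f₁ t = iteratedDeriv i f₂ t) :
    ∀ i ≤ k, iteratedDeriv i (fun s => (s, f₁ s)) t = iteratedDeriv i (fun s => (s, f₂ s)) t := by
  intro i hi
  have hF : iteratedFDeriv ℝ i f₁ t = iteratedFDeriv ℝ i f₂ t := by
    simp only [iteratedFDeriv_eq_equiv_comp, Function.comp_apply, h i hi]
  have := iteratedFDeriv_prodMk (f := fun s : ℝ => s) (g := f₁) (x := t) (n := ∞) (i := i)
    contDiffAt_id h₁ (by exact_mod_cast le_top)
  have h2 := iteratedFDeriv_prodMk (f := fun s : ℝ => s) (g := f₂) (x := t) (n := ∞) (i := i)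
    contDiffAt_id h₂ (by exact_mod_cast le_top)
  rw [hF] at this
  simp only [iteratedDeriv, this, h2]

/-- Equality of jets may be tested in a single adapted chart. -/
theorem Jet.mk_eq_of_chart {a b : LocalSection π} (e : AdaptedChart π)
    (he : a.toFun a.time ∈ e.chart.source) (hb : b.toFun b.time ∈ e.chart.source)
    (ht : a.time = b.time)
    (h : ∀ i ≤ k, iteratedDeriv i (e.components a.toFun) a.time =
      iteratedDeriv i (e.components b.toFun) b.time) : Jet.mk k a = Jet.mk k b := by
  have hax := e.contDiffAt_components a.isLocalSectionAt he
  have hbx := e.contDiffAt_components b.isLocalSectionAt hb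
  have ha2 := e.eventually_symm_components a.isLocalSectionAt he
  have hb2 := e.eventually_symm_components b.isLocalSectionAt hb
  rw [← ht] at h hbx hb2
  have h0 : e.components a.toFun a.time = e.components b.toFun a.time := by
    simpa using h 0 (Nat.zero_le _)
  have hpt : a.toFun a.time = b.toFun a.time := by
    rw [← ha2.self_of_nhds.2, ← hb2.self_of_nhds.2, h0]
  refine Jet.mk_eq_iff.2 ⟨ht, by rw [← ht]; exact hpt, fun e' he' => ?_⟩
  rw [← ht]
  let g : ℝ × (Fin n → ℝ) → (Fin n → ℝ) := fun p => (e'.chart (e.chart.symm p)).2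
  have hga : e'.components a.toFun =ᶠ[𝓝 a.time] g ∘ fun s => (s, e.components a.toFun s) := by
    filter_upwards [ha2] with s hs
    simp only [g, Function.comp_apply, hs.2]; rfl
  have hgb : e'.components b.toFun =ᶠ[𝓝 a.time] g ∘ fun s => (s, e.components b.toFun s) := by
    filter_upwards [hb2] with s hs
    simp only [g, Function.comp_apply, hs.2]; rfl
  have hg : ContDiffAt ℝ ∞ g (a.time, e.components a.toFun a.time) := by
    have h1 : ContMDiffAt 𝓘(ℝ, ℝ × (Fin n → ℝ)) (𝓡 (n + 1)) ∞ e.chart.symm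
        (a.time, e.components a.toFun a.time) :=
      e.contMDiffOn_symm.contMDiffAt (e.chart.open_target.mem_nhds ha2.self_of_nhds.1)
    have h2 : ContMDiffAt (𝓡 (n + 1)) 𝓘(ℝ, ℝ × (Fin n → ℝ)) ∞ e'.chart
        (e.chart.symm (a.time, e.components a.toFun a.time)) := by
      rw [ha2.self_of_nhds.2]
      exact e'.contMDiffOn.contMDiffAt (e'.chart.open_source.mem_nhds he')
    exact contDiffAt_snd.comp _ (h2.comp _ h1).contDiffAt
  intro i hi
  rw [hga.iteratedDeriv_eq, hgb.iteratedDeriv_eq]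
  exact iteratedDeriv_comp_congr (k := k) hg (contDiffAt_id.prodMk hax) (contDiffAt_id.prodMk hbx)
    (iteratedDeriv_prodMk_congr hax hbx h) i hi

/-- The polynomial curve with prescribed derivatives `q_0, …, q_k` at time `t`. -/
def taylorCurve (p : JetModel n k) (s : ℝ) : Fin n → ℝ :=
  ∑ i : Fin (k + 1), ((s - p.1) ^ (i : ℕ) / ((i : ℕ).factorial : ℝ)) • p.2 i

theorem contDiff_taylorCurve :
    ContDiff ℝ ∞ (fun x : JetModel n k × ℝ => taylorCurve x.1 x.2) := by
  unfold taylorCurve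
  fun_prop

theorem iteratedDeriv_taylorCurve (p : JetModel n k) (j : Fin (k + 1)) :
    iteratedDeriv j (taylorCurve p) p.1 = p.2 j := by
  have h1 : ∀ i : Fin (k + 1), iteratedDeriv (j : ℕ)
      (fun s : ℝ => ((s - p.1) ^ (i : ℕ) / ((i : ℕ).factorial : ℝ)) • p.2 i) p.1 =
      if i = j then p.2 j else 0 := by
    intro i
    rw [iteratedDeriv_smul_const (by fun_prop), iteratedDeriv_div_const,
      iteratedDeriv_comp_sub_const (j : ℕ) (fun x : ℝ => x ^ (i : ℕ)) p.1]
    simp only [sub_self, iteratedDeriv_fun_pow_zero]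
    by_cases hij : i = j
    · subst hij
      have : ((i : ℕ).factorial : ℝ) ≠ 0 := by exact_mod_cast (i : ℕ).factorial_ne_zero
      simp [this]
    · have : ¬ ((j : ℕ) = (i : ℕ)) := fun h => hij (Fin.ext h.symm)
      simp [this, hij]
  unfold taylorCurve
  rw [iteratedDeriv_fun_sum (fun i _ => by fun_prop)]
  simp [h1]

theorem taylorCurve_self (p : JetModel n k) : taylorCurve p p.1 = p.2 0 := by
  simpa using iteratedDeriv_taylorCurve p 0

/-- The local section which is polynomial in an adapted chart. -/
def AdaptedChart.polySection (e : AdaptedChart π) (p : JetModel n k) (s : ℝ) : E :=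
  e.chart.symm (s, taylorCurve p s)

theorem AdaptedChart.eventually_mem_target (e : AdaptedChart π) (p : JetModel n k)
    (hp : (p.1, p.2 0) ∈ e.chart.target) :
    ∀ᶠ s in 𝓝 p.1, (s, taylorCurve p s) ∈ e.chart.target := by
  have hc : ContinuousAt (fun s : ℝ => (s, taylorCurve p s)) p.1 :=
    (continuous_id.prodMk (contDiff_taylorCurve.continuous.comp
      (continuous_const.prodMk continuous_id))).continuousAt
  refine hc.preimage_mem_nhds (e.chart.open_target.mem_nhds ?_)
  rwa [taylorCurve_self]

theorem AdaptedChart.isLocalSectionAt_polySection (e : AdaptedChart π) (p : JetModel n k)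
    (hp : (p.1, p.2 0) ∈ e.chart.target) : IsLocalSectionAt π (e.polySection p) p.1 where
  section_eq := by
    filter_upwards [e.eventually_mem_target p hp] with s hs
    unfold polySection
    rw [← e.fst_eq _ (e.chart.map_target hs), e.chart.right_inv hs]
  smooth := by
    filter_upwards [e.eventually_mem_target p hp] with s hs
    have h1 : ContMDiffAt 𝓘(ℝ, ℝ × (Fin n → ℝ)) (𝓡 (n + 1)) ∞ e.chart.symm
        (s, taylorCurve p s) :=
      e.contMDiffOn_symm.contMDiffAt (e.chart.open_target.mem_nhds hs)
    have h2 : ContDiff ℝ ∞ (fun s : ℝ => (s, taylorCurve p s)) :=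
      contDiff_id.prodMk (contDiff_taylorCurve.comp (contDiff_const.prodMk contDiff_id))
    exact h1.comp s h2.contMDiff.contMDiffAt

theorem AdaptedChart.polySection_self (e : AdaptedChart π) (p : JetModel n k) :
    e.polySection p p.1 = e.chart.symm (p.1, p.2 0) := by
  rw [polySection, taylorCurve_self]

theorem AdaptedChart.components_polySection (e : AdaptedChart π) (p : JetModel n k)
    (hp : (p.1, p.2 0) ∈ e.chart.target) :
    e.components (e.polySection p) =ᶠ[𝓝 p.1] taylorCurve p := by
  filter_upwards [e.eventually_mem_target p hp] with s hs
  unfold components polySection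
  rw [e.chart.right_inv hs]

/-- The local section through given jet coordinates. -/
def AdaptedChart.ofCoords (e : AdaptedChart π) (p : JetModel n k)
    (hp : (p.1, p.2 0) ∈ e.chart.target) : LocalSection π :=
  ⟨p.1, e.polySection p, e.isLocalSectionAt_polySection p hp⟩

theorem AdaptedChart.ofCoords_base (e : AdaptedChart π) (p : JetModel n k)
    (hp : (p.1, p.2 0) ∈ e.chart.target) :
    (e.ofCoords p hp).toFun (e.ofCoords p hp).time = e.chart.symm (p.1, p.2 0) :=
  e.polySection_self p

theorem AdaptedChart.jetTarget_nonempty (e : AdaptedChart π) (k : ℕ) :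
    ∃ p : JetModel n k, (p.1, p.2 0) ∈ e.chart.target := by
  obtain ⟨x, hx⟩ := e.nonempty
  exact ⟨((e.chart x).1, fun _ => (e.chart x).2), e.chart.map_source hx⟩

open Classical in
/-- The natural coordinates `(t, q_0, …, q_k)`, `q_i = dⁱφ/dtⁱ`, induced on `J^k π` by an adapted
chart. -/
def AdaptedChart.jet (e : AdaptedChart π) (k : ℕ) : PartialEquiv (Jet π k) (JetModel n k) where
  toFun y := (y.time, fun i => iteratedDeriv i (e.components y.rep.toFun) y.time)
  invFun p := if hp : (p.1, p.2 0) ∈ e.chart.target then Jet.mk k (e.ofCoords p hp)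
    else Jet.mk k (e.ofCoords _ (e.jetTarget_nonempty k).choose_spec)
  source := {y | y.base ∈ e.chart.source}
  target := {p | (p.1, p.2 0) ∈ e.chart.target}
  map_source' y hy := by
    have h := e.eventually_symm_components y.rep.isLocalSectionAt
      (by rw [Jet.base_rep]; exact hy)
    have := h.self_of_nhds.1
    rw [Jet.time_rep] at this
    simpa using this
  map_target' p hp := by
    have hp' : (p.1, p.2 0) ∈ e.chart.target := hp
    rw [dif_pos hp']
    change e.polySection p p.1 ∈ e.chart.source
    rw [e.polySection_self]
    exact e.chart.map_target hp'
  left_inv' y hy := by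
    have h := e.eventually_symm_components y.rep.isLocalSectionAt
      (by rw [Jet.base_rep]; exact hy)
    have h1 := h.self_of_nhds.1
    rw [Jet.time_rep] at h1
    have hp : (y.time, iteratedDeriv ((0 : Fin (k + 1)) : ℕ)
        (e.components y.rep.toFun) y.time) ∈ e.chart.target := by simpa using h1
    rw [dif_pos hp]
    conv_rhs => rw [← y.mk_rep]
    refine Jet.mk_eq_of_chart e ?_ (by rw [Jet.base_rep]; exact hy) y.time_rep.symm ?_
    · rw [e.ofCoords_base]
      exact e.chart.map_target hp
    · intro i hi
      change iteratedDeriv i (e.components (e.polySection _)) y.time = _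
      rw [(e.components_polySection _ hp).iteratedDeriv_eq, y.time_rep]
      exact iteratedDeriv_taylorCurve
        ((y.time, fun i => iteratedDeriv i (e.components y.rep.toFun) y.time) : JetModel n k)
        ⟨i, Nat.lt_succ_of_le hi⟩
  right_inv' p hp := by
    have hp' : (p.1, p.2 0) ∈ e.chart.target := hp
    rw [dif_pos hp']
    have hr := Jet.mk_eq_iff.1 (Jet.mk_rep (Jet.mk k (e.ofCoords p hp')))
    refine Prod.ext rfl (funext fun i => ?_)
    have hs : (Jet.mk k (e.ofCoords p hp')).rep.toFun (Jet.mk k (e.ofCoords p hp')).rep.time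
        ∈ e.chart.source := by
      rw [Jet.base_rep]
      change e.polySection p p.1 ∈ e.chart.source
      rw [e.polySection_self]
      exact e.chart.map_target hp'
    have h2 := hr.2.2 e hs i (Nat.le_of_lt_succ i.2)
    rw [Jet.time_rep] at h2
    refine h2.trans ?_
    change iteratedDeriv i (e.components (e.polySection p)) p.1 = _
    rw [(e.components_polySection _ hp').iteratedDeriv_eq, iteratedDeriv_taylorCurve]

/-- The coordinates of a jet may be computed from any representative. -/
theorem AdaptedChart.jet_mk (e : AdaptedChart π) (a : LocalSection π)
    (ha : a.toFun a.time ∈ e.chart.source) : e.jet k (Jet.mk k a) =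
      (a.time, fun i : Fin (k + 1) => iteratedDeriv i (e.components a.toFun) a.time) := by
  have hr := Jet.mk_eq_iff.1 (Jet.mk_rep (Jet.mk k a))
  refine Prod.ext rfl (funext fun i => ?_)
  have h2 := hr.2.2 e (by rw [Jet.base_rep]; exact ha) i (Nat.le_of_lt_succ i.2)
  rw [Jet.time_rep] at h2
  exact h2

theorem AdaptedChart.jet_symm (e : AdaptedChart π) {p : JetModel n k}
    (hp : (p.1, p.2 0) ∈ e.chart.target) : (e.jet k).symm p = Jet.mk k (e.ofCoords p hp) :=
  dif_pos hp

/-- Derivatives with respect to one variable of a smooth function depend smoothly on all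
variables. -/
theorem contDiffOn_iteratedDeriv_snd {V W : Type*} [NormedAddCommGroup V] [NormedSpace ℝ V]
    [NormedAddCommGroup W] [NormedSpace ℝ W] {G : V × ℝ → W} {O : Set (V × ℝ)} (hO : IsOpen O)
    (hG : ContDiffOn ℝ ∞ G O) (i : ℕ) :
    ContDiffOn ℝ ∞ (fun x : V × ℝ => iteratedDeriv i (fun s => G (x.1, s)) x.2) O := by
  induction i with
  | zero => simpa using hG
  | succ i ih =>
    have h1 := (ih.fderiv_of_isOpen (m := ∞) hO (by simp)).clm_apply
      (contDiffOn_const (c := ((0 : V), (1 : ℝ))))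
    refine h1.congr fun x hx => ?_
    rw [iteratedDeriv_succ]
    have hd : HasFDerivAt (fun x : V × ℝ => iteratedDeriv i (fun s => G (x.1, s)) x.2) _ x :=
      ((ih.contDiffAt (hO.mem_nhds hx)).differentiableAt (by simp)).hasFDerivAt
    have h2 : HasDerivAt (fun s : ℝ => (x.1, s)) ((0 : V), (1 : ℝ)) x.2 :=
      (hasDerivAt_const _ _).prodMk (hasDerivAt_id _)
    exact (HasFDerivAt.comp_hasDerivAt x.2 hd h2).deriv

theorem AdaptedChart.jet_trans_source (e e' : AdaptedChart π) (k : ℕ) :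
    ((e.jet k).symm.trans (e'.jet k)).source =
      (fun p : JetModel n k => (p.1, p.2 0)) ⁻¹' (e.chart.symm.trans e'.chart).source := by
  ext p
  simp only [PartialEquiv.trans_source, PartialEquiv.symm_source, mem_inter_iff, mem_preimage,
    OpenPartialHomeomorph.trans_source, OpenPartialHomeomorph.symm_source]
  refine and_congr_right fun hp => ?_
  have hp' : (p.1, p.2 0) ∈ e.chart.target := hp
  rw [e.jet_symm hp']
  change e.polySection p p.1 ∈ e'.chart.source ↔ _
  rw [e.polySection_self]

theorem AdaptedChart.isOpen_jet_trans_source (e e' : AdaptedChart π) (k : ℕ) :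
    IsOpen ((e.jet k).symm.trans (e'.jet k)).source := by
  rw [e.jet_trans_source e']
  exact (e.chart.symm.trans e'.chart).open_source.preimage (by fun_prop)

/-- The changes of natural coordinates are smooth. -/
theorem AdaptedChart.contDiffOn_jet_trans (e e' : AdaptedChart π) (k : ℕ) :
    ContDiffOn ℝ ∞ ((e.jet k).symm.trans (e'.jet k)) ((e.jet k).symm.trans (e'.jet k)).source := by
  rw [e.jet_trans_source e']
  set S := (e.chart.symm.trans e'.chart).source
  let g : ℝ × (Fin n → ℝ) → (Fin n → ℝ) := fun p => (e'.chart (e.chart.symm p)).2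
  have hg : ContDiffOn ℝ ∞ g S := by
    have h1 : ContMDiffOn 𝓘(ℝ, ℝ × (Fin n → ℝ)) 𝓘(ℝ, ℝ × (Fin n → ℝ)) ∞
        (e'.chart ∘ e.chart.symm) S :=
      e'.contMDiffOn.comp (e.contMDiffOn_symm.mono (fun p hp => hp.1)) (fun p hp => hp.2)
    exact contDiff_snd.comp_contDiffOn h1.contDiffOn
  let O : Set (JetModel n k × ℝ) := (fun x => (x.2, taylorCurve x.1 x.2)) ⁻¹' S
  have hcd : ContDiff ℝ ∞ (fun x : JetModel n k × ℝ => (x.2, taylorCurve x.1 x.2)) :=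
    contDiff_snd.prodMk contDiff_taylorCurve
  have hO : IsOpen O := (e.chart.symm.trans e'.chart).open_source.preimage hcd.continuous
  have hG : ContDiffOn ℝ ∞ (fun x : JetModel n k × ℝ => g (x.2, taylorCurve x.1 x.2)) O :=
    ContDiffOn.comp (t := S) (g := g)
      (f := fun x : JetModel n k × ℝ => (x.2, taylorCurve x.1 x.2)) hg hcd.contDiffOn (fun _ hx => hx)
  have hmain : ContDiffOn ℝ ∞ (fun p : JetModel n k => ((p.1, fun i : Fin (k + 1) =>
      iteratedDeriv i (fun s => g (s, taylorCurve p s)) p.1) : JetModel n k))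
      ((fun p : JetModel n k => (p.1, p.2 0)) ⁻¹' S) := by
    refine contDiff_fst.contDiffOn.prodMk (contDiffOn_pi.2 fun i => ?_)
    have hd : ContDiff ℝ ∞ (fun p : JetModel n k => (p, p.1)) := contDiff_id.prodMk contDiff_fst
    refine ContDiffOn.comp (t := O) (f := fun p : JetModel n k => (p, p.1))
      (contDiffOn_iteratedDeriv_snd hO hG i) hd.contDiffOn ?_
    intro p hp
    change (p.1, taylorCurve p p.1) ∈ S
    rwa [taylorCurve_self]
  refine hmain.congr fun p hp => ?_
  have hp1 : (p.1, p.2 0) ∈ e.chart.target := hp.1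
  change e'.jet k ((e.jet k).symm p) = _
  rw [e.jet_symm hp1, e'.jet_mk]
  · refine Prod.ext rfl (funext fun i => ?_)
    rfl
  · change e.polySection p p.1 ∈ _
    rw [e.polySection_self]
    exact hp.2

open Classical in
/-- The prolongation `s ↦ j^k_s φ` of a local section (with a dummy value away from its domain). -/
def LocalSection.prolong (a : LocalSection π) (k : ℕ) (s : ℝ) : Jet π k :=
  if h : IsLocalSectionAt π a.toFun s then Jet.mk k ⟨s, a.toFun, h⟩ else Jet.mk k a

theorem LocalSection.prolong_time (a : LocalSection π) (k : ℕ) :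
    a.prolong k a.time = Jet.mk k a := dif_pos a.isLocalSectionAt

theorem Jet.prolong_rep {r : ℕ} (h : r ≤ k) (y : Jet π k) :
    y.rep.prolong r y.time = y.trunc h := by
  rw [← y.time_rep, LocalSection.prolong_time]
  conv_rhs => rw [← y.mk_rep]
  rfl

section Manifold

variable [IsManifold (𝓡 (n + 1)) ∞ E]

/-- A chosen adapted chart around each point of `E`. -/
def adaptedChartAt (π : ConfigBundle n E) (x : E) : AdaptedChart π :=
  (AdaptedChart.exists_mem π x).choose

theorem mem_adaptedChartAt (π : ConfigBundle n E) (x : E) :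
    x ∈ (adaptedChartAt π x).chart.source := (AdaptedChart.exists_mem π x).choose_spec

/-- The atlas of `J^k π` given by all natural coordinates. -/
def jetAtlas (π : ConfigBundle n E) (k : ℕ) : ChartedSpaceCore (JetModel n k) (Jet π k) where
  atlas := range fun e : AdaptedChart π => e.jet k
  chartAt y := (adaptedChartAt π y.base).jet k
  mem_chart_source y := mem_adaptedChartAt π y.base
  chart_mem_atlas y := mem_range_self _
  open_source := by
    rintro _ _ ⟨e, rfl⟩ ⟨e', rfl⟩
    exact e.isOpen_jet_trans_source e' k
  continuousOn_toFun := by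
    rintro _ _ ⟨e, rfl⟩ ⟨e', rfl⟩
    exact (e.contDiffOn_jet_trans e' k).continuousOn

instance : TopologicalSpace (Jet π k) := (jetAtlas π k).toTopologicalSpace

instance : ChartedSpace (JetModel n k) (Jet π k) := (jetAtlas π k).toChartedSpace

theorem mem_atlas_jet {c : OpenPartialHomeomorph (Jet π k) (JetModel n k)}
    (hc : c ∈ atlas (JetModel n k) (Jet π k)) :
    ∃ e : AdaptedChart π, c.toPartialEquiv = e.jet k := by
  change c ∈ ⋃ (e : PartialEquiv (Jet π k) (JetModel n k)) (he : e ∈ (jetAtlas π k).atlas),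
    {(jetAtlas π k).openPartialHomeomorph e he} at hc
  simp only [mem_iUnion, mem_singleton_iff] at hc
  obtain ⟨_, ⟨e, rfl⟩, rfl⟩ := hc
  exact ⟨e, rfl⟩

theorem chartAt_jet (y : Jet π k) : (chartAt (JetModel n k) y).toPartialEquiv =
    (adaptedChartAt π y.base).jet k := rfl

instance : IsManifold 𝓘(ℝ, JetModel n k) ∞ (Jet π k) := by
  refine isManifold_of_contDiffOn _ _ _ fun c c' hc hc' => ?_
  obtain ⟨e, he⟩ := mem_atlas_jet hc
  obtain ⟨e', he'⟩ := mem_atlas_jet hc'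
  have h := e.contDiffOn_jet_trans e' k
  rw [← he, ← he'] at h
  simpa using h

/-- The vertical directions `∂/∂q_i^A` of the model space. -/
abbrev VertModel (n k : ℕ) : Type := Fin (k + 1) → Fin n → ℝ

/-- The time component of a natural chart is the projection onto `ℝ`. -/
theorem fst_atlas_jet {c : OpenPartialHomeomorph (Jet π k) (JetModel n k)}
    (hc : c ∈ atlas (JetModel n k) (Jet π k)) (y : Jet π k) : (c y).1 = y.time := by
  obtain ⟨e, he⟩ := mem_atlas_jet hc
  change (c.toPartialEquiv y).1 = y.time
  rw [he]
  rfl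

/-- Changes of natural charts preserve `dt`. -/
theorem fst_coordChange (i j : atlas (JetModel n k) (Jet π k)) {y : Jet π k}
    (hi : y ∈ i.1.source) (hj : y ∈ j.1.source) (v : JetModel n k) :
    ((tangentBundleCore 𝓘(ℝ, JetModel n k) (Jet π k)).coordChange i j y v).1 = v.1 := by
  change (fderivWithin ℝ (j.1.extend 𝓘(ℝ, JetModel n k) ∘ (i.1.extend 𝓘(ℝ, JetModel n k)).symm)
    (range 𝓘(ℝ, JetModel n k)) (i.1.extend 𝓘(ℝ, JetModel n k) y) v).1 = v.1
  have hd := ((𝓘(ℝ, JetModel n k)).contDiffWithinAt_extendCoordChange' (n := ∞)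
    (IsManifold.subset_maximalAtlas i.2) (IsManifold.subset_maximalAtlas j.2)
    hi hj).differentiableWithinAt (by simp)
  simp only [modelWithCornersSelf_coe, range_id, fderivWithin_univ,
    differentiableWithinAt_univ] at hd ⊢
  have h1 := (hasFDerivAt_fst.comp _ hd.hasFDerivAt)
  have h2 : HasFDerivAt (Prod.fst ∘ (j.1.extend 𝓘(ℝ, JetModel n k) ∘
      (i.1.extend 𝓘(ℝ, JetModel n k)).symm)) (ContinuousLinearMap.fst ℝ ℝ (VertModel n k))
      (i.1.extend 𝓘(ℝ, JetModel n k) y) := by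
    refine (hasFDerivAt_fst (𝕜 := ℝ) (E := ℝ) (F := VertModel n k)).congr_of_eventuallyEq ?_
    have ht : i.1.target ∈ 𝓝 (i.1 y) := i.1.open_target.mem_nhds (i.1.map_source hi)
    filter_upwards [ht] with p hp
    change (j.1 (i.1.symm p)).1 = p.1
    rw [fst_atlas_jet j.2, ← fst_atlas_jet i.2, i.1.right_inv hp]
  exact congrArg (fun l => l v) (h1.unique h2)

/-- The restriction to vertical vectors of the tangent coordinate change. -/
def vertChange (i j : atlas (JetModel n k) (Jet π k)) (y : Jet π k) :
    VertModel n k →L[ℝ] VertModel n k :=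
  ((ContinuousLinearMap.snd ℝ ℝ (VertModel n k)).comp
    ((tangentBundleCore 𝓘(ℝ, JetModel n k) (Jet π k)).coordChange i j y)).comp
    (ContinuousLinearMap.inr ℝ ℝ (VertModel n k))

theorem inr_vertChange (i j : atlas (JetModel n k) (Jet π k)) {y : Jet π k}
    (hi : y ∈ i.1.source) (hj : y ∈ j.1.source) (v : VertModel n k) :
    ((0 : ℝ), vertChange i j y v) =
      (tangentBundleCore 𝓘(ℝ, JetModel n k) (Jet π k)).coordChange i j y ((0 : ℝ), v) :=
  Prod.ext (fst_coordChange i j hi hj (0, v)).symm rfl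

theorem contMDiffOn_vertChange (i j : atlas (JetModel n k) (Jet π k)) :
    ContMDiffOn 𝓘(ℝ, JetModel n k) 𝓘(ℝ, VertModel n k →L[ℝ] VertModel n k) ∞
      (vertChange i j) (i.1.source ∩ j.1.source) := by
  have : IsManifold 𝓘(ℝ, JetModel n k) (∞ + 1) (Jet π k) := inferInstanceAs (IsManifold _ ∞ _)
  have := tangentBundleCore.isContMDiff (n := ∞) (I := 𝓘(ℝ, JetModel n k)) (M := Jet π k)
  have h := (tangentBundleCore 𝓘(ℝ, JetModel n k) (Jet π k)).contMDiffOn_coordChange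
    (n := ∞) 𝓘(ℝ, JetModel n k) i j
  exact (contMDiffOn_const.clm_comp h).clm_comp contMDiffOn_const

/-- The bundle of linear forms on the vertical bundle of `J^k π → ℝ`. Since the forms vanishing on
vertical vectors are the multiples of `dt`, this is the quotient bundle
`T^*(J^k π) / (π̄^k)^* T^*ℝ`; see `quotMap_surjective` and `quotMap_eq_iff`. -/
def restrictedCore (π : ConfigBundle n E) (k : ℕ) :
    VectorBundleCore ℝ (Jet π k) (VertModel n k →L[ℝ] ℝ) (atlas (JetModel n k) (Jet π k)) where
  baseSet i := i.1.source
  isOpen_baseSet i := i.1.open_source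
  indexAt := achart (JetModel n k)
  mem_baseSet_at y := mem_chart_source (JetModel n k) y
  coordChange i j y :=
    (ContinuousLinearMap.compL ℝ (VertModel n k) (VertModel n k) ℝ).flip (vertChange j i y)
  coordChange_self i y hy β := by
    ext1 v
    change β (vertChange i i y v) = β v
    have h := (tangentBundleCore 𝓘(ℝ, JetModel n k) (Jet π k)).coordChange_self i y hy ((0 : ℝ), v)
    exact congrArg (fun w : JetModel n k => β w.2) h
  continuousOn_coordChange i j :=
    (ContinuousLinearMap.continuous _).comp_continuousOn
      ((contMDiffOn_vertChange j i).continuousOn.mono fun _ h => ⟨h.2, h.1⟩)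
  coordChange_comp i j l y hy β := by
    obtain ⟨⟨hi, hj⟩, hl⟩ := hy
    ext1 v
    change β (vertChange j i y (vertChange l j y v)) = β (vertChange l i y v)
    have h := (tangentBundleCore 𝓘(ℝ, JetModel n k) (Jet π k)).coordChange_comp l j i y
      ⟨⟨hl, hj⟩, hi⟩ ((0 : ℝ), v)
    rw [← inr_vertChange l j hl hj, ← inr_vertChange j i hj hi, ← inr_vertChange l i hl hi] at h
    have h2 : vertChange j i y (vertChange l j y v) = vertChange l i y v :=
      (Prod.mk.inj h).2
    exact congrArg β h2

instance : (restrictedCore π k).IsContMDiff 𝓘(ℝ, JetModel n k) ∞ where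
  contMDiffOn_coordChange i j :=
    ((ContinuousLinearMap.contDiff _).contMDiff).comp_contMDiffOn
      ((contMDiffOn_vertChange j i).mono fun _ h => ⟨h.2, h.1⟩)

/-- The cotangent bundle `T^*(J^k π)`. -/
abbrev CotangentJet (π : ConfigBundle n E) (k : ℕ) : Type _ :=
  Bundle.TotalSpace (JetModel n k →L[ℝ] ℝ) fun y : Jet π k =>
    TangentSpace 𝓘(ℝ, JetModel n k) y →L[ℝ] Bundle.Trivial (Jet π k) ℝ y

/-- The restricted momentum bundle `J^k π^* = T^*(J^k π) / (π̄^k)^* T^*ℝ`. -/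
abbrev RestrictedJetDual (π : ConfigBundle n E) (k : ℕ) : Type _ :=
  Bundle.TotalSpace (VertModel n k →L[ℝ] ℝ) (restrictedCore π k).Fiber

/-- The quotient map `μ : T^*(J^k π) → J^k π^*`, restriction of linear forms to vertical vectors. -/
def quotMap (α : CotangentJet π k) : RestrictedJetDual π k :=
  ⟨α.proj, (show JetModel n k →L[ℝ] ℝ from α.2).comp
    (ContinuousLinearMap.inr ℝ ℝ (VertModel n k))⟩

theorem mfderiv_time (y : Jet π k) :
    mfderiv 𝓘(ℝ, JetModel n k) 𝓘(ℝ, ℝ) (Jet.time : Jet π k → ℝ) y =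
      ContinuousLinearMap.fst ℝ ℝ (VertModel n k) := by
  have hloc : ∀ p ∈ (chartAt (JetModel n k) y).target,
      Jet.time ((chartAt (JetModel n k) y).symm p) = p.1 := fun p hp => by
    rw [← fst_atlas_jet (chart_mem_atlas (JetModel n k) y),
      (chartAt (JetModel n k) y).right_inv hp]
  have hev : (Jet.time ∘ (chartAt (JetModel n k) y).symm) =ᶠ[𝓝 (chartAt (JetModel n k) y y)]
      Prod.fst := by
    filter_upwards [(chartAt (JetModel n k) y).open_target.mem_nhds
      ((chartAt (JetModel n k) y).map_source (mem_chart_source _ y))] with p hp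
    exact hloc p hp
  have hd : HasFDerivAt (Jet.time ∘ (chartAt (JetModel n k) y).symm)
      (ContinuousLinearMap.fst ℝ ℝ (VertModel n k)) (chartAt (JetModel n k) y y) :=
    (hasFDerivAt_fst (𝕜 := ℝ) (E := ℝ) (F := VertModel n k)).congr_of_eventuallyEq hev
  have hm : HasMFDerivAt 𝓘(ℝ, JetModel n k) 𝓘(ℝ, ℝ) (Jet.time : Jet π k → ℝ) y
      (ContinuousLinearMap.fst ℝ ℝ (VertModel n k)) := by
    refine ⟨?_, ?_⟩
    · have h1 : ContinuousOn (fun z => (chartAt (JetModel n k) y z).1)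
          (chartAt (JetModel n k) y).source :=
        continuous_fst.comp_continuousOn (chartAt (JetModel n k) y).continuousOn
      have h2 := h1.continuousAt ((chartAt (JetModel n k) y).open_source.mem_nhds
        (mem_chart_source _ y))
      refine h2.congr (Eventually.of_forall fun z => ?_)
      exact fst_atlas_jet (chart_mem_atlas (JetModel n k) y) z
    · exact hd.hasFDerivWithinAt
  exact hm.mfderiv

/-- `μ` is onto. -/
theorem quotMap_surjective : Function.Surjective (quotMap : CotangentJet π k → _) := by
  rintro ⟨y, β⟩
  refine ⟨⟨y, ContinuousLinearMap.comp (show VertModel n k →L[ℝ] ℝ from β)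
    (ContinuousLinearMap.snd ℝ ℝ (VertModel n k))⟩, ?_⟩
  unfold quotMap
  congr 1

/-- The kernel of `μ` is spanned by `dt`. -/
theorem quotMap_eq_iff (y : Jet π k) (a b : JetModel n k →L[ℝ] ℝ) :
    quotMap (⟨y, a⟩ : CotangentJet π k) = quotMap ⟨y, b⟩ ↔
      ∃ c : ℝ, ∀ v : TangentSpace 𝓘(ℝ, JetModel n k) y, b v = a v +
        c * (show ℝ from mfderiv 𝓘(ℝ, JetModel n k) 𝓘(ℝ, ℝ) (Jet.time : Jet π k → ℝ) y v) := by
  have key : quotMap (⟨y, a⟩ : CotangentJet π k) = quotMap ⟨y, b⟩ ↔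
      ∀ v : VertModel n k, a (0, v) = b (0, v) := by
    constructor
    · intro h v
      have h2 := Bundle.TotalSpace.mk_inj.1 h
      exact congrArg (fun l : VertModel n k →L[ℝ] ℝ => l v) h2
    · intro h
      refine Bundle.TotalSpace.mk_inj.2 ?_
      exact ContinuousLinearMap.ext (f := a.comp (ContinuousLinearMap.inr ℝ ℝ (VertModel n k)))
        (g := b.comp (ContinuousLinearMap.inr ℝ ℝ (VertModel n k))) h
  rw [key, mfderiv_time]
  constructor
  · intro h
    refine ⟨b (1, 0) - a (1, 0), fun (w : JetModel n k) => ?_⟩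
    have hw : w = w.1 • ((1 : ℝ), (0 : VertModel n k)) + (0, w.2) := by ext <;> simp
    change b w = a w + (b (1, 0) - a (1, 0)) * w.1
    rw [hw, map_add, map_add, map_smul, map_smul, h w.2]
    simp
    ring
  · rintro ⟨c, hc⟩ v
    have h2 : b (0, v) = a (0, v) + c * 0 := hc ((0 : ℝ), v)
    rw [h2, mul_zero, add_zero]

/-- The total time derivative `(d_T f)(j^{k+1}_t φ) = d/ds (f (j^k_s φ))` at `s = t`. -/
def totalDeriv (f : Jet π k → ℝ) (y : Jet π (k + 1)) : ℝ :=
  deriv (fun s => f (y.rep.prolong k s)) y.time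

/-- The iterated total time derivatives `d_T^i f`, functions on `J^{k+i} π`. -/
def iterTotalDeriv (f : Jet π k → ℝ) : (i : ℕ) → Jet π (k + i) → ℝ
  | 0 => f
  | i + 1 => totalDeriv (iterTotalDeriv f i)

/-- The partial derivative `∂f/∂q_i^A` in natural coordinates. -/
def AdaptedChart.partialDeriv (e : AdaptedChart π) (f : Jet π k → ℝ) (i : Fin (k + 1))
    (A : Fin n) (y : Jet π k) : ℝ :=
  fderiv ℝ (f ∘ (e.jet k).symm) (e.jet k y) (0, Pi.single i (Pi.single A 1))

variable {m : ℕ}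

/-- The Jacobi–Ostrogradsky momenta of a Lagrangian of order `m + 1` in natural coordinates,
`p^r_A = ∑_{i=0}^{m-r} (-1)^i d_T^i (∂L/∂q^A_{r+1+i})` for `0 ≤ r ≤ m`. -/
def AdaptedChart.momentum (e : AdaptedChart π) (L : Jet π (m + 1) → ℝ) (r : Fin (m + 1))
    (A : Fin n) (y : Jet π (2 * m + 1)) : ℝ :=
  ∑ i : Fin (m + 1 - r), (-1) ^ (i : ℕ) *
    iterTotalDeriv (e.partialDeriv L ⟨r + 1 + i, by omega⟩ A) i
      (y.trunc (show m + 1 + i ≤ 2 * m + 1 by omega))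

/-- The linear form `∑ p^r_A dq_r^A` on vertical vectors. -/
def momentumForm (p : Fin (m + 1) → Fin n → ℝ) : VertModel n m →L[ℝ] ℝ :=
  ∑ r, ∑ A, p r A • (ContinuousLinearMap.proj A).comp
    (ContinuousLinearMap.proj (R := ℝ) (φ := fun _ : Fin (m + 1) => Fin n → ℝ) r)

/-- The restricted Legendre–Ostrogradsky map `FL : J^{2m+1} π → J^m π^*` of a Lagrangian of order
`m + 1`. Its value at `y` is `∑ p^r_A dq_r^A`, written in the natural coordinates that Mathlib uses
to identify the tangent space at the projection of `y` to `J^m π` with the model space. -/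
def legendre (L : Jet π (m + 1) → ℝ) (y : Jet π (2 * m + 1)) : RestrictedJetDual π m :=
  let x : Jet π m := y.trunc (by omega)
  ⟨x, momentumForm fun r A => (adaptedChartAt π x.base).momentum L r A y⟩

/-- A Lagrangian is hyperregular if its restricted Legendre–Ostrogradsky map is a global
diffeomorphism. -/
def IsHyperregular (L : Jet π (m + 1) → ℝ) : Prop :=
  ∃ Φ : Diffeomorph 𝓘(ℝ, JetModel n (2 * m + 1))
      (𝓘(ℝ, JetModel n m).prod 𝓘(ℝ, VertModel n m →L[ℝ] ℝ))
      (Jet π (2 * m + 1)) (RestrictedJetDual π m) ∞,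
    ⇑Φ = legendre L

/-- The product `J^{2m+1} π × T^*(J^m π)` containing the extended jet-momentum bundle. -/
abbrev UnifiedAmbient (π : ConfigBundle n E) (m : ℕ) : Type _ :=
  Jet π (2 * m + 1) × CotangentJet π m

/-- The extended jet-momentum bundle `W = J^{2m+1} π ×_{J^m π} T^*(J^m π)`. -/
def unifiedBundle (π : ConfigBundle n E) (m : ℕ) : Set (UnifiedAmbient π m) :=
  {w | w.2.proj = w.1.trunc (by omega)}

/-- The coefficient `Ĉ` of `dt` in the coupling form: `Ĉ(y, α) = ⟨α, (j^m φ)_* ∂/∂t⟩` for a section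
`φ` representing `y`. -/
def coupling (w : UnifiedAmbient π m) : ℝ :=
  (show JetModel n m →L[ℝ] ℝ from w.2.2)
    (mfderiv 𝓘(ℝ, ℝ) 𝓘(ℝ, JetModel n m) (w.1.rep.prolong m) w.1.time (1 : ℝ))

/-- The Hamiltonian submanifold `W_o ⊂ W`, where `Ĉ = L̂`. -/
def hamiltonianSubmanifold (L : Jet π (m + 1) → ℝ) : Set (UnifiedAmbient π m) :=
  {w | w ∈ unifiedBundle π m ∧ coupling w = L (w.1.trunc (by omega))}

/-- The submanifold `W_1 ⊂ W_o`, where the momenta are given by the Legendre–Ostrogradsky map. -/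
def legendreSubmanifold (L : Jet π (m + 1) → ℝ) : Set (UnifiedAmbient π m) :=
  {w | w ∈ hamiltonianSubmanifold L ∧ quotMap w.2 = legendre L w.1}

/-- The projection `ρ_1^1 : W_1 → J^{2m+1} π`. -/
def rhoOne (L : Jet π (m + 1) → ℝ) (w : legendreSubmanifold L) : Jet π (2 * m + 1) := w.1.1

/-- The projection `ρ̂_2^1 : W_1 → J^m π^*`, `(y, α) ↦ μ(α)`. -/
def rhoHatTwo (L : Jet π (m + 1) → ℝ) (w : legendreSubmanifold L) : RestrictedJetDual π m :=
  quotMap w.1.2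

/-- An atlas on `W_1` (with the subspace topology) for which `W_1` is a smooth manifold embedded in
`J^{2m+1} π × T^*(J^m π)`. -/
structure IsEmbeddedStructure (L : Jet π (m + 1) → ℝ)
    (cs : ChartedSpace (JetModel n (2 * m + 1)) (legendreSubmanifold L)) : Prop where
  isManifold : IsManifold 𝓘(ℝ, JetModel n (2 * m + 1)) ∞ (legendreSubmanifold L)
  isSmoothEmbedding : Manifold.IsSmoothEmbedding 𝓘(ℝ, JetModel n (2 * m + 1))
    (𝓘(ℝ, JetModel n (2 * m + 1)).prod
      (𝓘(ℝ, JetModel n m).prod 𝓘(ℝ, JetModel n m →L[ℝ] ℝ))) ∞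
    (Subtype.val : legendreSubmanifold L → UnifiedAmbient π m)

end Manifold

end HigherOrderMechanics

end

open HigherOrderMechanics

/-! Write `k = m + 1`. A jet `y` in `J^{2m+1} π` determines the velocity `v` of `s ↦ j^m_s φ` at the
projection `x` of `y` to `J^m π`. Since `dt(v) = 1`, the tangent space at `x` is the direct sum of
the line through `v` and the vertical space. A covector at `x` is therefore the same thing as its
value on `v` together with its restriction to vertical vectors, and both data can be prescribed
freely. The value on `v` is `Ĉ` and the restriction is `μ(α)`, so the equations `Ĉ = L` and `μ(α) =
FL(y)` have exactly one solution over each `y`. Hence `W_1` is the graph of a map `legendreLift L`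
defined on all of `J^{2m+1} π` (`mem_legendreSubmanifold_iff`).

This map is smooth (`contMDiff_legendreLift`): in natural coordinates `v` is `(1, q_1, …, q_{m+1})`
(`coordChange_velocity`), which is smooth in `y` because `m + 1 ≤ 2m + 1`, and the splitting is
compatible with changes of chart (`covectorOf_comp_coordChange`). The graph of a smooth map is
embedded, and its projection `ρ_1^1` to the domain is a diffeomorphism for any structure of embedded
submanifold (`exists_rhoOneDiffeomorph`). The identity `ρ̂_2^1 = FL ∘ ρ_1^1` is one of the defining
equations of `W_1`, so `ρ̂_2^1` is a composite of two diffeomorphisms when `FL` is one. -/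

/-! ### Graphs of smooth maps are immersed -/

section Graph

variable {𝕜 : Type*} [NontriviallyNormedField 𝕜]
  {E E' : Type*} [NormedAddCommGroup E] [NormedSpace 𝕜 E]
  [NormedAddCommGroup E'] [NormedSpace 𝕜 E']
  {H H' : Type*} [TopologicalSpace H] [TopologicalSpace H']
  {I : ModelWithCorners 𝕜 E H} {J : ModelWithCorners 𝕜 E' H'}
  {M N : Type*} [TopologicalSpace M] [ChartedSpace H M] [TopologicalSpace N] [ChartedSpace H' N]
  {r : ℕ∞ω}

/-- The chart of `M × N` which straightens the graph of `f`: it is `(c x, d y - d (f x))`, read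
through the boundaryless model `J`. -/
noncomputable def OpenPartialHomeomorph.graphChart (J : ModelWithCorners 𝕜 E' H') [J.Boundaryless]
    (f : M → N) (c : OpenPartialHomeomorph M H) (d : OpenPartialHomeomorph N H')
    (hf : ContinuousOn f c.source) (hfd : MapsTo f c.source d.source) :
    OpenPartialHomeomorph (M × N) (ModelProd H H') where
  toFun p := (c p.1, J.symm (J (d p.2) - J (d (f p.1))))
  invFun q := (c.symm q.1, d.symm (J.symm (J q.2 + J (d (f (c.symm q.1))))))
  source := c.source ×ˢ d.source
  target := {q | q.1 ∈ c.target ∧ J.symm (J q.2 + J (d (f (c.symm q.1)))) ∈ d.target}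
  map_source' := by
    rintro ⟨x, y⟩ ⟨hx, hy⟩
    have hx' : x ∈ c.source := hx
    have hy' : y ∈ d.source := hy
    simp [c.map_source hx', hx', d.map_source hy', J.right_inv (J.range_eq_univ ▸ mem_univ _)]
  map_target' := by
    rintro ⟨u, h⟩ ⟨hu, hh⟩
    exact ⟨c.map_target hu, d.map_target hh⟩
  left_inv' := by
    rintro ⟨x, y⟩ ⟨hx, hy⟩
    have hx' : x ∈ c.source := hx
    have hy' : y ∈ d.source := hy
    simp [hx', hy', J.right_inv (J.range_eq_univ ▸ mem_univ _)]
  right_inv' := by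
    rintro ⟨u, h⟩ ⟨hu, hh⟩
    have hu' : u ∈ c.target := hu
    simp [hu', d.right_inv hh, J.right_inv (J.range_eq_univ ▸ mem_univ _)]
  open_source := c.open_source.prod d.open_source
  -- The target is not a product: it consists of the points over `c.target` whose second coordinate,
  -- shifted back by `f`, lands in `d.target`.
  open_target := by
    have h1 : ContinuousOn (fun q : H × H' => J.symm (J q.2 + J (d (f (c.symm q.1)))))
        (Prod.fst ⁻¹' c.target) := by
      refine J.continuous_symm.comp_continuousOn
        ((J.continuous.comp continuous_snd).continuousOn.add (J.continuous.comp_continuousOn ?_))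
      exact d.continuousOn.comp (hf.comp (c.continuousOn_symm.comp continuous_fst.continuousOn
        fun _ h => h) fun _ h => c.map_target h) fun _ h => hfd (c.map_target h)
    exact h1.isOpen_inter_preimage (c.open_target.preimage continuous_fst) d.open_target
  continuousOn_toFun := by
    refine (c.continuousOn.comp continuous_fst.continuousOn fun _ h => h.1).prodMk
      (J.continuous_symm.comp_continuousOn ((J.continuous.comp_continuousOn
        (d.continuousOn.comp continuous_snd.continuousOn fun _ h => h.2)).sub
        (J.continuous.comp_continuousOn (d.continuousOn.comp
          (hf.comp continuous_fst.continuousOn fun _ h => h.1) fun _ h => hfd h.1))))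
  continuousOn_invFun := by
    have h1 : ContinuousOn (fun q : H × H' => c.symm q.1)
        {q | q.1 ∈ c.target ∧ J.symm (J q.2 + J (d (f (c.symm q.1)))) ∈ d.target} :=
      c.continuousOn_symm.comp continuous_fst.continuousOn fun _ h => h.1
    refine h1.prodMk (d.continuousOn_symm.comp (J.continuous_symm.comp_continuousOn
      ((J.continuous.comp continuous_snd).continuousOn.add (J.continuous.comp_continuousOn
        (d.continuousOn.comp (hf.comp h1 ?_) ?_)))) fun _ h => h.2)
    · exact fun _ h => c.map_target h.1
    · exact fun _ h => hfd (c.map_target h.1)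

/-- The straightening chart and its inverse are composites of `f`, the charts `c` and `d`, the model
maps, and addition or subtraction in the model vector space, all of class `C^r`. -/
theorem OpenPartialHomeomorph.graphChart_mem_maximalAtlas [J.Boundaryless]
    [IsManifold I r M] [IsManifold J r N] {f : M → N} {c : OpenPartialHomeomorph M H}
    {d : OpenPartialHomeomorph N H'} (hc : c ∈ IsManifold.maximalAtlas I r M)
    (hd : d ∈ IsManifold.maximalAtlas J r N) (hf : ContMDiffOn I J r f c.source)
    (hfd : MapsTo f c.source d.source) :
    OpenPartialHomeomorph.graphChart J f c d hf.continuousOn hfd ∈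
      IsManifold.maximalAtlas (I.prod J) r (M × N) := by
  have hJ : ContMDiff 𝓘(𝕜, E') J r J.symm := by
    rw [← contMDiffOn_univ, ← J.range_eq_univ]
    exact J.contMDiffOn_symm
  have hc1 := contMDiffOn_of_mem_maximalAtlas hc
  have hc2 := contMDiffOn_symm_of_mem_maximalAtlas hc
  have hd1 := contMDiffOn_of_mem_maximalAtlas hd
  have hd2 := contMDiffOn_symm_of_mem_maximalAtlas hd
  -- The criterion for the maximal atlas regards the model as charted over itself, whereas the
  -- product rules for smooth maps need the product structure. The two agree.
  have key : chartedSpaceSelf (ModelProd H H') = prodChartedSpace H H H' H' :=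
    chartedSpaceSelf_prod.symm
  refine OpenPartialHomeomorph.mem_maximalAtlas_of_contMDiffOn _ ?_ ?_ <;> rw [key]
  · refine ContMDiffOn.prodMk (s := c.source ×ˢ d.source)
      (hc1.comp contMDiffOn_fst fun _ h => h.1) (hJ.comp_contMDiffOn ?_)
    exact (J.contMDiff.comp_contMDiffOn
        (hd1.comp contMDiffOn_snd fun _ h => h.2)).sub
        (J.contMDiff.comp_contMDiffOn (hd1.comp
          (hf.comp contMDiffOn_fst fun _ h => h.1) fun _ h => hfd h.1))
  · set S : Set (H × H') := {q | q.1 ∈ c.target ∧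
      J.symm (J q.2 + J (d (f (c.symm q.1)))) ∈ d.target}
    have h1 : ContMDiffOn (I.prod J) I r (fun q : H × H' => c.symm q.1) S :=
      hc2.comp contMDiffOn_fst fun _ h => h.1
    have h2 : ContMDiffOn (I.prod J) J r (fun q : H × H' => d (f (c.symm q.1))) S :=
      hd1.comp (hf.comp h1 fun _ h => c.map_target h.1) fun _ h => hfd (c.map_target h.1)
    have h3 : ContMDiffOn (I.prod J) 𝓘(𝕜, E') r (fun q : H × H' => J q.2) S :=
      J.contMDiff.comp_contMDiffOn contMDiffOn_snd
    have h4 : ContMDiffOn (I.prod J) J r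
        (fun q : H × H' => J.symm (J q.2 + J (d (f (c.symm q.1))))) S :=
      hJ.comp_contMDiffOn (h3.add (J.contMDiff.comp_contMDiffOn h2))
    have h5 : ContMDiffOn (I.prod J) J r
        (fun q : H × H' => d.symm (J.symm (J q.2 + J (d (f (c.symm q.1)))))) S :=
      hd2.comp h4 fun _ h => h.2
    exact h1.prodMk h5

/-- The graph map of a `C^r` map is an immersion. -/
theorem ContMDiff.isImmersionOfComplement_graph [J.Boundaryless]
    [IsManifold I r M] [IsManifold J r N] {f : M → N} (hf : ContMDiff I J r f) :
    Manifold.IsImmersionOfComplement E' I (I.prod J) r (fun x => (x, f x)) := by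
  intro x
  set d := chartAt H' (f x)
  -- The chart at `x` is shrunk so that `f` sends its whole domain into that of `d`, as the
  -- straightening chart requires.
  have hO : IsOpen (f ⁻¹' d.source) := d.open_source.preimage hf.continuous
  set c := (chartAt H x).restr (f ⁻¹' d.source)
  have hc : c ∈ IsManifold.maximalAtlas I r M :=
    restr_mem_maximalAtlas (contDiffGroupoid r I)
      (IsManifold.chart_mem_maximalAtlas (I := I) (n := r) x) hO
  have hfd : MapsTo f c.source d.source := fun y hy => hO.interior_eq.subset hy.2
  have hxc : x ∈ c.source := ⟨mem_chart_source H x, by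
    rw [hO.interior_eq]
    exact mem_chart_source H' (f x)⟩
  -- In these charts the graph map reads `u ↦ (u, 0)`, so the complement is `E'` and no linear
  -- change is needed.
  refine Manifold.IsImmersionAtOfComplement.mk_of_charts (ContinuousLinearEquiv.refl 𝕜 (E × E')) c
    (OpenPartialHomeomorph.graphChart J f c d hf.continuous.continuousOn hfd)
    hxc ⟨hxc, mem_chart_source H' (f x)⟩ hc
    (OpenPartialHomeomorph.graphChart_mem_maximalAtlas hc
      (IsManifold.chart_mem_maximalAtlas (f x)) hf.contMDiffOn hfd)
    (fun y hy => ⟨hy, hfd hy⟩) ?_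
  intro u hu
  have h1 := (c.extend I).right_inv hu
  refine Prod.ext h1 ?_
  simp [OpenPartialHomeomorph.graphChart, J.right_inv (J.range_eq_univ ▸ mem_univ _)]

end Graph

/-! ### Smooth structures transported along a homeomorphism -/

section Pullback

variable {𝕜 : Type*} [NontriviallyNormedField 𝕜]
  {E E' : Type*} [NormedAddCommGroup E] [NormedSpace 𝕜 E]
  [NormedAddCommGroup E'] [NormedSpace 𝕜 E']
  {H H' : Type*} [TopologicalSpace H] [TopologicalSpace H']
  {I : ModelWithCorners 𝕜 E H} {J : ModelWithCorners 𝕜 E' H'}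
  {M N W : Type*} [TopologicalSpace M] [ChartedSpace H M] [TopologicalSpace N] [ChartedSpace H' N]
  [TopologicalSpace W] {r : ℕ∞ω}

variable (H) in
/-- The charted space structure pulled back along a homeomorphism. -/
@[reducible] noncomputable def Homeomorph.pullbackChartedSpace (h : W ≃ₜ M) :
    ChartedSpace H W where
  atlas := (fun c => h.transOpenPartialHomeomorph c) '' atlas H M
  chartAt w := h.transOpenPartialHomeomorph (chartAt H (h w))
  mem_chart_source w := mem_chart_source H (h w)
  chart_mem_atlas _ := mem_image_of_mem _ (chart_mem_atlas H _)

-- The homeomorphism cancels in every transition map, so compatibility of pulled back charts is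
-- literally compatibility of the original ones.
omit [ChartedSpace H M] in
theorem Homeomorph.transOpenPartialHomeomorph_symm_trans (h : W ≃ₜ M)
    (c c' : OpenPartialHomeomorph M H) :
    (h.transOpenPartialHomeomorph c).symm.trans (h.transOpenPartialHomeomorph c') =
      c.symm.trans c' := by
  refine OpenPartialHomeomorph.ext _ _ (fun u => ?_) (fun u => ?_) ?_
  · simp
  · simp
  · ext u
    simp

theorem Homeomorph.transOpenPartialHomeomorph_mem_maximalAtlas (h : W ≃ₜ M)
    {c : OpenPartialHomeomorph M H} (hc : c ∈ IsManifold.maximalAtlas I r M) :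
    letI := h.pullbackChartedSpace H
    h.transOpenPartialHomeomorph c ∈ IsManifold.maximalAtlas I r W := by
  let := h.pullbackChartedSpace H
  rintro _ ⟨c', hc', rfl⟩
  simp only [Homeomorph.transOpenPartialHomeomorph_symm_trans]
  exact hc c' hc'

theorem Homeomorph.isManifold_pullback [IsManifold I r M] (h : W ≃ₜ M) :
    letI := h.pullbackChartedSpace H
    IsManifold I r W := by
  let := h.pullbackChartedSpace H
  refine { compatible := ?_ }
  rintro _ _ ⟨c, hc, rfl⟩ ⟨c', hc', rfl⟩
  simp only [Homeomorph.transOpenPartialHomeomorph_symm_trans]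
  exact (contDiffGroupoid r I).compatible hc hc'

omit [ChartedSpace H M] in
theorem Homeomorph.extend_transOpenPartialHomeomorph_target (h : W ≃ₜ M)
    (c : OpenPartialHomeomorph M H) :
    ((h.transOpenPartialHomeomorph c).extend I).target = (c.extend I).target := rfl

omit [ChartedSpace H M] in
theorem Homeomorph.apply_extend_transOpenPartialHomeomorph_symm (h : W ≃ₜ M)
    (c : OpenPartialHomeomorph M H) (u : E) :
    h (((h.transOpenPartialHomeomorph c).extend I).symm u) = (c.extend I).symm u :=
  h.apply_symm_apply _

/-- With the domain chart pulled back along `h` and the codomain chart kept, the local expression of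
`g ∘ h` is that of `g`. -/
theorem Manifold.IsImmersionOfComplement.comp_homeomorph {F : Type*} [NormedAddCommGroup F]
    [NormedSpace 𝕜 F] {g : M → N} (hg : Manifold.IsImmersionOfComplement F I J r g) (h : W ≃ₜ M) :
    letI := h.pullbackChartedSpace H
    Manifold.IsImmersionOfComplement F I J r (g ∘ h) := by
  let := h.pullbackChartedSpace H
  intro w
  have hw := hg (h w)
  refine Manifold.IsImmersionAtOfComplement.mk_of_charts hw.equiv
    (h.transOpenPartialHomeomorph hw.domChart) hw.codChart hw.mem_domChart_source
    hw.mem_codChart_source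
    (h.transOpenPartialHomeomorph_mem_maximalAtlas hw.domChart_mem_maximalAtlas)
    hw.codChart_mem_maximalAtlas (fun v hv => hw.source_subset_preimage_source hv) ?_
  rw [h.extend_transOpenPartialHomeomorph_target]
  refine EqOn.trans (fun u _ => ?_) hw.writtenInCharts
  simp only [Function.comp_apply, h.apply_extend_transOpenPartialHomeomorph_symm]

end Pullback

/-! ### Projections and prolongations in natural jet coordinates -/

namespace HigherOrderMechanics

variable {n : ℕ} {E : Type*} [TopologicalSpace E]
  [ChartedSpace (EuclideanSpace ℝ (Fin (n + 1))) E]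
  {π : ConfigBundle n E} {k r : ℕ}

theorem Jet.trunc_eq (h : r ≤ k) (y : Jet π k) : y.trunc h = Jet.mk r y.rep := by
  conv_lhs => rw [← y.mk_rep]
  rfl

theorem Jet.base_trunc (h : r ≤ k) (y : Jet π k) : (y.trunc h).base = y.base := by
  rw [y.trunc_eq h, ← y.base_rep]
  rfl

theorem AdaptedChart.jet_trunc (e : AdaptedChart π) (h : r ≤ k) {y : Jet π k}
    (hy : y.base ∈ e.chart.source) :
    e.jet r (y.trunc h) = (y.time, fun i => (e.jet k y).2 (Fin.castLE (by omega) i)) := by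
  rw [y.trunc_eq h, e.jet_mk _ (by rwa [y.base_rep]), y.time_rep]
  rfl

/-- Being a local section at `s` is an open condition on `s`, so the dummy branch of `prolong` is
never met near the base time. -/
theorem LocalSection.eventually_jet_prolong (a : LocalSection π) (e : AdaptedChart π)
    (ha : a.toFun a.time ∈ e.chart.source) (k : ℕ) :
    ∀ᶠ s in 𝓝 a.time, (a.prolong k s).base ∈ e.chart.source ∧
      e.jet k (a.prolong k s) =
        (s, fun i : Fin (k + 1) => iteratedDeriv i (e.components a.toFun) s) := by
  have h := a.isLocalSectionAt
  have hc : ∀ᶠ s in 𝓝 a.time, a.toFun s ∈ e.chart.source :=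
    h.contMDiffAt.continuousAt.preimage_mem_nhds (e.chart.open_source.mem_nhds ha)
  filter_upwards [hc, h.section_eq.eventually_nhds, h.smooth.eventually_nhds] with s h1 h2 h3
  have hs : IsLocalSectionAt π a.toFun s := ⟨h2, h3⟩
  rw [show a.prolong k s = Jet.mk k ⟨s, a.toFun, hs⟩ from dif_pos hs]
  exact ⟨h1, e.jet_mk ⟨s, a.toFun, hs⟩ h1⟩

theorem LocalSection.contDiffAt_jetCurve (a : LocalSection π) (e : AdaptedChart π)
    (ha : a.toFun a.time ∈ e.chart.source) (k : ℕ) :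
    ContDiffAt ℝ ∞ (fun s => ((s, fun i : Fin (k + 1) =>
      iteratedDeriv i (e.components a.toFun) s) : JetModel n k)) a.time := by
  refine contDiffAt_id.prodMk (contDiffAt_pi.2 fun i => ?_)
  have h := (e.contDiffAt_components a.isLocalSectionAt ha).iteratedFDeriv_right
    (i := i) (m := ∞) (by rfl)
  simp only [iteratedDeriv]
  -- The iterated derivative is the iterated Fréchet derivative evaluated at the constant vector
  -- `1`, a continuous linear operation.
  exact (ContinuousMultilinearMap.apply ℝ (fun _ : Fin (i : ℕ) => ℝ) (Fin n → ℝ)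
    (fun _ => 1)).contDiff.contDiffAt.comp _ h

theorem LocalSection.hasDerivAt_jetCurve (a : LocalSection π) (e : AdaptedChart π)
    (ha : a.toFun a.time ∈ e.chart.source) (k : ℕ) :
    HasDerivAt (fun s => ((s, fun i : Fin (k + 1) =>
      iteratedDeriv i (e.components a.toFun) s) : JetModel n k))
      (1, fun i : Fin (k + 1) => iteratedDeriv (i + 1) (e.components a.toFun) a.time) a.time := by
  have h := (a.contDiffAt_jetCurve e ha k).differentiableAt (by simp)
  refine (hasDerivAt_id _).prodMk (hasDerivAt_pi.2 fun i => ?_)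
  rw [iteratedDeriv_succ]
  have h2 : DifferentiableAt ℝ (fun s => fun i : Fin (k + 1) =>
    iteratedDeriv i (e.components a.toFun) s) a.time := h.snd
  exact (differentiableAt_pi.1 h2 i).hasDerivAt

/-! ### Smoothness on jet bundles and the velocity of a jet -/

section Manifold

variable [IsManifold (𝓡 (n + 1)) ∞ E]

/-- The atlas contains the natural coordinates of every adapted chart, not only of those chosen by
`adaptedChartAt`. -/
theorem AdaptedChart.contMDiffOn_jet (e : AdaptedChart π) (k : ℕ) :
    ContMDiffOn 𝓘(ℝ, JetModel n k) 𝓘(ℝ, JetModel n k) ∞ (e.jet k) (e.jet k).source := by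
  let c := (jetAtlas π k).openPartialHomeomorph (e.jet k) (mem_range_self e)
  have hc : c ∈ atlas (JetModel n k) (Jet π k) :=
    mem_iUnion₂.2 ⟨_, mem_range_self e, mem_singleton c⟩
  exact contMDiffOn_of_mem_maximalAtlas (IsManifold.subset_maximalAtlas hc)

theorem AdaptedChart.contMDiffOn_jet_symm (e : AdaptedChart π) (k : ℕ) :
    ContMDiffOn 𝓘(ℝ, JetModel n k) 𝓘(ℝ, JetModel n k) ∞ (e.jet k).symm (e.jet k).target := by
  let c := (jetAtlas π k).openPartialHomeomorph (e.jet k) (mem_range_self e)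
  have hc : c ∈ atlas (JetModel n k) (Jet π k) :=
    mem_iUnion₂.2 ⟨_, mem_range_self e, mem_singleton c⟩
  exact contMDiffOn_symm_of_mem_maximalAtlas (IsManifold.subset_maximalAtlas hc)

theorem AdaptedChart.isOpen_jet_source (e : AdaptedChart π) (k : ℕ) :
    IsOpen (e.jet k).source :=
  ((jetAtlas π k).openPartialHomeomorph (e.jet k) (mem_range_self e)).open_source

theorem AdaptedChart.isOpen_jet_target (e : AdaptedChart π) (k : ℕ) :
    IsOpen (e.jet k).target :=
  ((jetAtlas π k).openPartialHomeomorph (e.jet k) (mem_range_self e)).open_target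

/-- The projections `J^k π → J^r π` are smooth. -/
theorem contMDiff_trunc (h : r ≤ k) :
    ContMDiff 𝓘(ℝ, JetModel n k) 𝓘(ℝ, JetModel n r) ∞ (Jet.trunc h : Jet π k → Jet π r) := by
  intro y₀
  let e := adaptedChartAt π y₀.base
  have hy₀ : y₀ ∈ (e.jet k).source := mem_adaptedChartAt π y₀.base
  have hsrc : ∀ y ∈ (e.jet k).source, y.trunc h ∈ (e.jet r).source := fun y hy => by
    change (y.trunc h).base ∈ e.chart.source
    rw [y.base_trunc h]
    exact hy
  have heq : ∀ y ∈ (e.jet k).source, e.jet r (y.trunc h) =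
      ((e.jet k y).1, fun i => (e.jet k y).2 (Fin.castLE (by omega) i)) := fun y hy =>
    e.jet_trunc h hy
  -- In coordinates the projection forgets `q_{r+1}, …, q_k`; this is linear.
  have hlin : ContDiff ℝ ∞ fun p : JetModel n k =>
      ((p.1, fun i => p.2 (Fin.castLE (by omega) i)) : JetModel n r) := by fun_prop
  have hmain : ContMDiffOn 𝓘(ℝ, JetModel n k) 𝓘(ℝ, JetModel n r) ∞
      (fun y : Jet π k => (e.jet r).symm
        ((e.jet k y).1, fun i => (e.jet k y).2 (Fin.castLE (by omega) i))) (e.jet k).source := by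
    refine (e.contMDiffOn_jet_symm r).comp
      (hlin.contMDiff.comp_contMDiffOn (e.contMDiffOn_jet k)) fun y hy => ?_
    have htgt := (e.jet r).map_source (hsrc y hy)
    rw [heq y hy] at htgt
    exact htgt
  refine (hmain.congr fun y hy => ?_).contMDiffAt ((e.isOpen_jet_source k).mem_nhds hy₀)
  rw [← heq y hy, (e.jet r).left_inv (hsrc y hy)]

theorem LocalSection.contMDiffAt_prolong (a : LocalSection π) (k : ℕ) :
    ContMDiffAt 𝓘(ℝ, ℝ) 𝓘(ℝ, JetModel n k) ∞ (a.prolong k) a.time := by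
  let e := adaptedChartAt π (a.toFun a.time)
  have ha : a.toFun a.time ∈ e.chart.source := mem_adaptedChartAt π _
  have hev := a.eventually_jet_prolong e ha k
  have htgt := (e.jet k).map_source hev.self_of_nhds.1
  rw [hev.self_of_nhds.2] at htgt
  have h1 := ((e.contMDiffOn_jet_symm k).contMDiffAt
    ((e.isOpen_jet_target k).mem_nhds htgt)).comp a.time
      (a.contDiffAt_jetCurve e ha k).contMDiffAt
  refine h1.congr_of_eventuallyEq ?_
  filter_upwards [hev] with s hs
  rw [Function.comp_apply, ← hs.2]
  exact ((e.jet k).left_inv hs.1).symm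

/-- The velocity at time `t` of the prolongation `s ↦ j^r_s φ` of a section representing a jet. -/
noncomputable def Jet.velocity (r : ℕ) (y : Jet π k) : JetModel n r :=
  mfderiv 𝓘(ℝ, ℝ) 𝓘(ℝ, JetModel n r) (y.rep.prolong r) y.time (1 : ℝ)

/-- The coordinates of the velocity in a natural chart are `(1, q_1, …, q_{r+1})`. -/
theorem coordChange_velocity (h : r + 1 ≤ k) (y : Jet π k) (x₀ : Jet π r)
    (hx₀ : y.trunc (by omega) ∈ (chartAt (JetModel n r) x₀).source) :
    (tangentBundleCore 𝓘(ℝ, JetModel n r) (Jet π r)).coordChange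
      (achart (JetModel n r) (y.trunc (show r ≤ k by omega))) (achart (JetModel n r) x₀)
      (y.trunc (by omega)) (y.velocity r) =
      (1, fun i : Fin (r + 1) => ((adaptedChartAt π x₀.base).jet k y).2
        ⟨i + 1, by omega⟩) := by
  set e := adaptedChartAt π x₀.base
  set x := y.trunc (show r ≤ k by omega)
  have hb : y.base ∈ e.chart.source := by
    rw [← y.base_trunc (show r ≤ k by omega)]
    exact hx₀
  have ha : y.rep.toFun y.rep.time ∈ e.chart.source := by rwa [y.base_rep]
  have hx : y.rep.prolong r y.rep.time = x := by
    rw [y.time_rep]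
    exact y.prolong_rep (by omega)
  have hd := y.rep.hasDerivAt_jetCurve e ha r
  -- In the chart the prolongation is the curve `(s, φ, φ', …, φ^{(r)})`, whose derivative is `(1,
  -- φ', …, φ^{(r+1)})`. The condition `r + 1 ≤ k` makes these derivatives coordinates of `y`
  -- itself.
  have hd2 : HasDerivAt (fun s => chartAt (JetModel n r) x₀ (y.rep.prolong r s)) _ y.rep.time :=
    hd.congr_of_eventuallyEq ((y.rep.eventually_jet_prolong e ha r).mono fun s hs => hs.2)
  have hm : MDifferentiableAt 𝓘(ℝ, ℝ) 𝓘(ℝ, JetModel n r) (y.rep.prolong r) y.rep.time :=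
    (y.rep.contMDiffAt_prolong r).mdifferentiableAt (by simp)
  have hc : MDifferentiableAt 𝓘(ℝ, JetModel n r) 𝓘(ℝ, JetModel n r)
      (chartAt (JetModel n r) x₀) x := mdifferentiableAt_atlas (chart_mem_atlas _ x₀) hx₀
  -- The chain rule gives the same derivative a second way: the differential of the chart at `x₀`,
  -- which is the tangent coordinate change, applied to the velocity.
  have hcomp := mfderiv_comp_apply_of_eq (I := 𝓘(ℝ, ℝ)) y.rep.time hc hm hx (1 : ℝ)
  rw [mfderiv_chartAt_eq_tangentCoordChange hx₀, mfderiv_eq_fderiv, y.time_rep] at hcomp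
  rw [y.time_rep] at hd2
  refine hcomp.symm.trans ?_
  exact hd2.deriv

end Manifold
end HigherOrderMechanics

/-! ### Splitting covectors along the velocity, and the lift of the Legendre map -/

namespace HigherOrderMechanics

variable {n : ℕ} {E : Type*} [TopologicalSpace E]
  [ChartedSpace (EuclideanSpace ℝ (Fin (n + 1))) E]
  {π : ConfigBundle n E} {k r m : ℕ} [IsManifold (𝓡 (n + 1)) ∞ E]

theorem contMDiff_jet_snd_apply (e : AdaptedChart π) (k : ℕ) (i : Fin (k + 1)) :
    ContMDiffOn 𝓘(ℝ, JetModel n k) 𝓘(ℝ, Fin n → ℝ) ∞ (fun y => (e.jet k y).2 i)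
      (e.jet k).source :=
  ContMDiff.comp_contMDiffOn (g := fun p : JetModel n k => p.2 i)
    (contMDiff_iff_contDiff.2 (by fun_prop)) (e.contMDiffOn_jet k)

theorem velocity_fst (h : r + 1 ≤ k) (y : Jet π k) : (y.velocity r).1 = 1 := by
  have h1 := coordChange_velocity h y (y.trunc (by omega)) (mem_chart_source _ _)
  have h2 := (tangentBundleCore 𝓘(ℝ, JetModel n r) (Jet π r)).coordChange_self
    (achart (JetModel n r) (y.trunc (show r ≤ k by omega))) _
    (mem_chart_source (JetModel n r) (y.trunc (show r ≤ k by omega))) (y.velocity r)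
  exact congrArg Prod.fst (h2.symm.trans h1)

/-- The linear form with vertical part `β` and value `c` on `τ`, provided that `τ` has time
component `1`. -/
noncomputable def covectorOf (τ : JetModel n k) (c : ℝ) (β : VertModel n k →L[ℝ] ℝ) :
    JetModel n k →L[ℝ] ℝ :=
  c • ContinuousLinearMap.fst ℝ ℝ (VertModel n k) +
    β.comp (ContinuousLinearMap.snd ℝ ℝ (VertModel n k) -
      (ContinuousLinearMap.fst ℝ ℝ (VertModel n k)).smulRight τ.2)

theorem covectorOf_apply (τ : JetModel n k) (c : ℝ) (β : VertModel n k →L[ℝ] ℝ)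
    (v : JetModel n k) : covectorOf τ c β v = c * v.1 + β (v.2 - v.1 • τ.2) := rfl

theorem covectorOf_apply_self {τ : JetModel n k} (hτ : τ.1 = 1) (c : ℝ)
    (β : VertModel n k →L[ℝ] ℝ) : covectorOf τ c β τ = c := by
  simp [covectorOf_apply, hτ]

theorem covectorOf_comp_inr (τ : JetModel n k) (c : ℝ) (β : VertModel n k →L[ℝ] ℝ) :
    (covectorOf τ c β).comp (ContinuousLinearMap.inr ℝ ℝ (VertModel n k)) = β := by
  ext1 v
  simp [covectorOf_apply]

/-- As `dt(τ) = 1`, every vector is a multiple of `τ` plus a vertical vector, so a covector is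
recovered from its value on `τ` and its vertical restriction. -/
theorem eq_covectorOf {τ : JetModel n k} (hτ : τ.1 = 1) (a : JetModel n k →L[ℝ] ℝ) :
    a = covectorOf τ (a τ) (a.comp (ContinuousLinearMap.inr ℝ ℝ (VertModel n k))) := by
  refine ContinuousLinearMap.ext fun v => ?_
  have hv : v = v.1 • τ + (0, v.2 - v.1 • τ.2) := by
    refine Prod.ext ?_ ?_ <;> simp [hτ]
  rw [covectorOf_apply]
  conv_lhs => rw [hv, map_add, map_smul]
  simp [mul_comm]

/-- Tangent coordinate changes preserve `dt`, hence vertical vectors, and carry `τ` to `τ₀`. The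
splitting along `τ` thus becomes the splitting along `τ₀`: the value `c` is unchanged and the
vertical part follows the cocycle of the restricted bundle. -/
theorem covectorOf_comp_coordChange (i j : atlas (JetModel n k) (Jet π k)) {x : Jet π k}
    (hi : x ∈ i.1.source) (hj : x ∈ j.1.source) {τ τ₀ : JetModel n k} (hτ : τ.1 = 1)
    (hτ₀ : (tangentBundleCore 𝓘(ℝ, JetModel n k) (Jet π k)).coordChange i j x τ = τ₀)
    (c : ℝ) (β : VertModel n k →L[ℝ] ℝ) :
    (covectorOf τ c β).comp
      ((tangentBundleCore 𝓘(ℝ, JetModel n k) (Jet π k)).coordChange j i x) =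
      covectorOf τ₀ c ((restrictedCore π k).coordChange i j x β) := by
  have hT : (tangentBundleCore 𝓘(ℝ, JetModel n k) (Jet π k)).coordChange j i x τ₀ = τ := by
    rw [← hτ₀, (tangentBundleCore 𝓘(ℝ, JetModel n k) (Jet π k)).coordChange_comp i j i x
      ⟨⟨hi, hj⟩, hi⟩, (tangentBundleCore 𝓘(ℝ, JetModel n k) (Jet π k)).coordChange_self i x hi]
  have hτ₀1 : τ₀.1 = 1 := by rw [← hτ₀, fst_coordChange i j hi hj, hτ]
  rw [eq_covectorOf hτ₀1 (ContinuousLinearMap.comp (covectorOf τ c β) _)]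
  congr 1
  · change covectorOf τ c β
      ((tangentBundleCore 𝓘(ℝ, JetModel n k) (Jet π k)).coordChange j i x τ₀) = c
    rw [hT, covectorOf_apply_self hτ]
  · ext1 v
    change covectorOf τ c β ((tangentBundleCore 𝓘(ℝ, JetModel n k) (Jet π k)).coordChange j i x
      ((0 : ℝ), v)) = β (vertChange j i x v)
    rw [← inr_vertChange j i hj hi, covectorOf_apply]
    simp

/-- The covector over `y` with value `L` on the velocity and vertical part `legendre L y`. -/
noncomputable def legendreLift (L : Jet π (m + 1) → ℝ) (y : Jet π (2 * m + 1)) :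
    CotangentJet π m :=
  ⟨y.trunc (by omega), covectorOf (y.velocity m) (L (y.trunc (by omega))) (legendre L y).2⟩

theorem restrictedJetDual_mk_inj {x : Jet π k} {β β' : VertModel n k →L[ℝ] ℝ}
    (h : (⟨x, β⟩ : RestrictedJetDual π k) = ⟨x, β'⟩) : β = β' :=
  eq_of_heq (Bundle.TotalSpace.mk.inj h).2

/-- The three conditions defining `W_1` fix, in turn, the base point of the covector, its value on
the velocity and its vertical part. By `eq_covectorOf` nothing else is left free. -/
theorem mem_legendreSubmanifold_iff (L : Jet π (m + 1) → ℝ) (w : UnifiedAmbient π m) :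
    w ∈ legendreSubmanifold L ↔ w.2 = legendreLift L w.1 := by
  obtain ⟨y, x, a⟩ := w
  have hτ : (y.velocity m).1 = 1 := velocity_fst (by omega) y
  constructor
  · rintro ⟨⟨h1, h2⟩, h3⟩
    have h1' : x = y.trunc (by omega) := h1
    subst h1'
    have h2' : a (y.velocity m) = L (y.trunc (by omega)) := h2
    have h3' : ContinuousLinearMap.comp (show JetModel n m →L[ℝ] ℝ from a)
        (ContinuousLinearMap.inr ℝ ℝ (VertModel n m)) = (legendre L y).2 :=
      restrictedJetDual_mk_inj h3
    refine Bundle.TotalSpace.mk_inj.2 ?_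
    rw [← h2', ← h3']
    exact eq_covectorOf hτ _
  · intro h
    have h' : (⟨x, a⟩ : CotangentJet π m) = legendreLift L y := h
    rw [h']
    refine ⟨⟨rfl, covectorOf_apply_self hτ _ _⟩, ?_⟩
    exact Bundle.TotalSpace.mk_inj.2 (covectorOf_comp_inr _ _ _)

theorem inCoordinates_cotangent {x₀ x : Jet π k} (hx : x ∈ (chartAt (JetModel n k) x₀).source)
    (a : TangentSpace 𝓘(ℝ, JetModel n k) x →L[ℝ] Bundle.Trivial (Jet π k) ℝ x) :
    ContinuousLinearMap.inCoordinates (JetModel n k) (TangentSpace 𝓘(ℝ, JetModel n k)) ℝ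
      (Bundle.Trivial (Jet π k) ℝ) x₀ x x₀ x a =
      ContinuousLinearMap.comp (show JetModel n k →L[ℝ] ℝ from a)
        ((tangentBundleCore 𝓘(ℝ, JetModel n k) (Jet π k)).coordChange
          (achart (JetModel n k) x₀) (achart (JetModel n k) x) x) := by
  rw [ContinuousLinearMap.inCoordinates, TangentBundle.symmL_trivializationAt_eq_core hx]
  simp only [Bundle.Trivial.fiberBundle_trivializationAt',
    Bundle.Trivial.continuousLinearMapAt_trivialization]
  rfl

/-- Smoothness of `legendre L` is a hypothesis, to be supplied by hyperregularity; the coordinate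
formula for the momenta is not differentiated. What remains is that the velocity and `L` vary
smoothly with `y`. -/
theorem contMDiff_legendreLift {L : Jet π (m + 1) → ℝ}
    (hL : ContMDiff 𝓘(ℝ, JetModel n (m + 1)) 𝓘(ℝ, ℝ) ∞ L)
    (hFL : ContMDiff 𝓘(ℝ, JetModel n (2 * m + 1))
      (𝓘(ℝ, JetModel n m).prod 𝓘(ℝ, VertModel n m →L[ℝ] ℝ)) ∞ (legendre L)) :
    ContMDiff 𝓘(ℝ, JetModel n (2 * m + 1))
      (𝓘(ℝ, JetModel n m).prod 𝓘(ℝ, JetModel n m →L[ℝ] ℝ)) ∞ (legendreLift L) := by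
  intro y₀
  -- Smoothness into the cotangent bundle amounts to smoothness of the base map and of the covector
  -- read in the trivialization at the base point of `legendreLift L y₀`.
  rw [contMDiffAt_hom_bundle]
  have htr : ContMDiffAt 𝓘(ℝ, JetModel n (2 * m + 1)) 𝓘(ℝ, JetModel n m) ∞
      (Jet.trunc (show m ≤ 2 * m + 1 by omega) : Jet π (2 * m + 1) → Jet π m) y₀ :=
    contMDiff_trunc (by omega) y₀
  refine ⟨htr, ?_⟩
  set x₀ : Jet π m := y₀.trunc (by omega)
  set e := adaptedChartAt π x₀.base
  have hb := (Bundle.contMDiffAt_totalSpace.1 (hFL y₀)).2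
  have hL' : ContMDiffAt 𝓘(ℝ, JetModel n (2 * m + 1)) 𝓘(ℝ, ℝ) ∞
      (fun y : Jet π (2 * m + 1) => L (y.trunc (by omega))) y₀ :=
    (hL.comp (contMDiff_trunc (by omega))) y₀
  have hy₀ : y₀ ∈ (e.jet (2 * m + 1)).source := by
    change y₀.base ∈ e.chart.source
    rw [← y₀.base_trunc (show m ≤ 2 * m + 1 by omega)]
    exact mem_adaptedChartAt π _
  have hq : ContMDiffAt 𝓘(ℝ, JetModel n (2 * m + 1)) 𝓘(ℝ, VertModel n m) ∞
      (fun y : Jet π (2 * m + 1) => fun i : Fin (m + 1) =>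
        (e.jet (2 * m + 1) y).2 ⟨i + 1, by omega⟩) y₀ :=
    (contMDiffOn_pi_space.2 fun i => contMDiff_jet_snd_apply e (2 * m + 1) _).contMDiffAt
      ((e.isOpen_jet_source _).mem_nhds hy₀)
  -- This is the expected coordinate expression of the lift: velocity `(1, q_1, …, q_{m+1})`, value
  -- `L`, and the vertical part read in the restricted bundle over the fixed chart. It is smooth
  -- because `covectorOf` is built from its arguments by continuous linear and bilinear operations.
  have hmain : ContMDiffAt 𝓘(ℝ, JetModel n (2 * m + 1)) 𝓘(ℝ, JetModel n m →L[ℝ] ℝ) ∞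
      (fun y : Jet π (2 * m + 1) => covectorOf
        ((1, fun i : Fin (m + 1) => (e.jet (2 * m + 1) y).2 ⟨i + 1, by omega⟩) : JetModel n m)
        (L (y.trunc (by omega)))
        (trivializationAt (VertModel n m →L[ℝ] ℝ) (restrictedCore π m).Fiber
          (legendre L y₀).proj (legendre L y)).2) y₀ := by
    unfold covectorOf
    refine (hL'.smul contMDiffAt_const).add (hb.clm_comp (contMDiffAt_const.sub ?_))
    exact ((ContinuousLinearMap.smulRightL ℝ (JetModel n m) (VertModel n m)
      (ContinuousLinearMap.fst ℝ ℝ (VertModel n m))).contMDiff).contMDiffAt.comp y₀ hq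
  refine hmain.congr_of_eventuallyEq ?_
  have hev : ∀ᶠ y : Jet π (2 * m + 1) in 𝓝 y₀, y.trunc (show m ≤ 2 * m + 1 by omega) ∈
      (chartAt (JetModel n m) x₀).source :=
    htr.continuousAt.preimage_mem_nhds ((chartAt (JetModel n m) x₀).open_source.mem_nhds
      (mem_chart_source _ x₀))
  filter_upwards [hev] with y hy
  -- The fibre over `y` is written in the chart at its own base point, which moves with `y`; the
  -- change to the fixed chart at `x₀` turns the lift into the expression above.
  have hcc := covectorOf_comp_coordChange (achart (JetModel n m) (y.trunc (by omega)))
    (achart (JetModel n m) x₀) (mem_chart_source _ _) hy (velocity_fst (by omega) y)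
    (coordChange_velocity (by omega) y x₀ hy) (L (y.trunc (by omega))) (legendre L y).2
  refine Eq.trans ?_ hcc
  exact inCoordinates_cotangent hy _

end HigherOrderMechanics

/-! ### The embedded structure of `W_1` and its projections -/

namespace HigherOrderMechanics

variable {n : ℕ} {E : Type*} [TopologicalSpace E]
  [ChartedSpace (EuclideanSpace ℝ (Fin (n + 1))) E]
  {π : ConfigBundle n E} {m : ℕ} [IsManifold (𝓡 (n + 1)) ∞ E]

theorem legendreSubmanifold_snd_eq {L : Jet π (m + 1) → ℝ} (w : legendreSubmanifold L) :
    w.1.2 = legendreLift L w.1.1 := (mem_legendreSubmanifold_iff L w.1).1 w.2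

/-- The section `y ↦ (y, legendreLift L y)` of `ρ_1^1`. -/
noncomputable def legendreSection (L : Jet π (m + 1) → ℝ) (y : Jet π (2 * m + 1)) :
    legendreSubmanifold L :=
  ⟨(y, legendreLift L y), (mem_legendreSubmanifold_iff L _).2 rfl⟩

theorem legendreSection_rhoOne {L : Jet π (m + 1) → ℝ} (w : legendreSubmanifold L) :
    legendreSection L (rhoOne L w) = w :=
  Subtype.ext (Prod.ext rfl (legendreSubmanifold_snd_eq w).symm)

/-- `ρ_1^1` is a homeomorphism when `W_1` is the graph of a continuous map. -/
noncomputable def rhoOneHomeomorph {L : Jet π (m + 1) → ℝ} (h : Continuous (legendreLift L)) :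
    legendreSubmanifold L ≃ₜ Jet π (2 * m + 1) where
  toFun := rhoOne L
  invFun := legendreSection L
  left_inv := legendreSection_rhoOne
  right_inv _ := rfl
  continuous_toFun := continuous_fst.comp continuous_subtype_val
  continuous_invFun := (continuous_id.prodMk h).subtype_mk _

/-- The charts of `J^{2m+1} π` are pulled back along `ρ_1^1`. The inclusion is then the graph
immersion preceded by this homeomorphism, and it is a topological embedding because `W_1` carries
the subspace topology. -/
theorem exists_isEmbeddedStructure {L : Jet π (m + 1) → ℝ}
    (h : ContMDiff 𝓘(ℝ, JetModel n (2 * m + 1))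
      (𝓘(ℝ, JetModel n m).prod 𝓘(ℝ, JetModel n m →L[ℝ] ℝ)) ∞ (legendreLift L)) :
    ∃ cs : ChartedSpace (JetModel n (2 * m + 1)) (legendreSubmanifold L),
      IsEmbeddedStructure L cs := by
  let ρ := rhoOneHomeomorph h.continuous
  let cs : ChartedSpace (JetModel n (2 * m + 1)) (legendreSubmanifold L) :=
    ρ.pullbackChartedSpace _
  have himm := h.isImmersionOfComplement_graph.comp_homeomorph ρ
  refine ⟨cs, ρ.isManifold_pullback, ?_, IsEmbedding.subtypeVal⟩
  have hval : (Subtype.val : legendreSubmanifold L → UnifiedAmbient π m) =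
      (fun y => (y, legendreLift L y)) ∘ ρ :=
    funext fun w => Prod.ext rfl (legendreSubmanifold_snd_eq w)
  rw [hval]
  exact himm.isImmersion

/-- `ρ_1^1` is a diffeomorphism for every structure of embedded submanifold on `W_1`. -/
theorem exists_rhoOneDiffeomorph {L : Jet π (m + 1) → ℝ}
    (h : ContMDiff 𝓘(ℝ, JetModel n (2 * m + 1))
      (𝓘(ℝ, JetModel n m).prod 𝓘(ℝ, JetModel n m →L[ℝ] ℝ)) ∞ (legendreLift L))
    (cs : ChartedSpace (JetModel n (2 * m + 1)) (legendreSubmanifold L))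
    (hcs : IsEmbeddedStructure L cs) :
    ∃ Φ : Diffeomorph 𝓘(ℝ, JetModel n (2 * m + 1)) 𝓘(ℝ, JetModel n (2 * m + 1))
      (legendreSubmanifold L) (Jet π (2 * m + 1)) ∞, ⇑Φ = rhoOne L :=
  ⟨{ (rhoOneHomeomorph h.continuous).toEquiv with
      -- Only the embedding property of `cs` is available. Forwards, `ρ_1^1` is the inclusion
      -- followed by the first projection. Backwards, a continuous map into the source of an
      -- immersion is smooth once its composite with the immersion is, and here the composite is the
      -- graph map of `legendreLift L`.
      contMDiff_toFun := contMDiff_fst.comp hcs.isSmoothEmbedding.contMDiff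
      contMDiff_invFun := fun y =>
        (ContMDiffAt.iff_comp_isImmersionAt (hcs.isSmoothEmbedding.isImmersion.isImmersionAt _)).2
          ⟨(rhoOneHomeomorph h.continuous).symm.continuous.continuousAt,
            contMDiffAt_id.prodMk (h y)⟩ }, rfl⟩

theorem rhoHatTwo_eq (L : Jet π (m + 1) → ℝ) : rhoHatTwo L = legendre L ∘ rhoOne L :=
  funext fun w => w.2.2

end HigherOrderMechanics

theorem mainTheorem11 {n m : ℕ} {E : Type*} [TopologicalSpace E] [T2Space E]
    [SecondCountableTopology E] [ChartedSpace (EuclideanSpace ℝ (Fin (n + 1))) E]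
    [IsManifold (𝓡 (n + 1)) ∞ E] (π : ConfigBundle n E) (L : Jet π (m + 1) → ℝ)
    (hL : ContMDiff 𝓘(ℝ, JetModel n (m + 1)) 𝓘(ℝ, ℝ) ∞ L) (hreg : IsHyperregular L) :
    (∃ cs : ChartedSpace (JetModel n (2 * m + 1)) (legendreSubmanifold L),
      IsEmbeddedStructure L cs) ∧
    (∀ cs : ChartedSpace (JetModel n (2 * m + 1)) (legendreSubmanifold L),
      IsEmbeddedStructure L cs →
      ∃ Φ : Diffeomorph 𝓘(ℝ, JetModel n (2 * m + 1))
          (𝓘(ℝ, JetModel n m).prod 𝓘(ℝ, VertModel n m →L[ℝ] ℝ))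
          (legendreSubmanifold L) (RestrictedJetDual π m) ∞,
        ⇑Φ = rhoHatTwo L) ∧
    rhoHatTwo L = legendre L ∘ rhoOne L := by

  obtain ⟨Ψ, hΨ⟩ := hreg
  -- The embedded structure needs only that `FL` is smooth; its smooth inverse enters in the
  -- composite `Φ.trans Ψ` below.
  have h := contMDiff_legendreLift hL (hΨ ▸ Ψ.contMDiff)
  refine ⟨exists_isEmbeddedStructure h, fun cs hcs => ?_, rhoHatTwo_eq L⟩
  obtain ⟨Φ, hΦ⟩ := exists_rhoOneDiffeomorph h cs hcs
  refine ⟨Φ.trans Ψ, ?_⟩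
  rw [rhoHatTwo_eq, ← hΨ, ← hΦ]
  rfl
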